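/- Let $n\ge 0$ and $m\ge 3$ be integers and let $F_n$ be the free group on $n$ generators. Let $(G_i)_{i\ge1}$ be the derived $m$-series of $F_n$, defined by $G_1=F_n$ and $G_{i+1}=[G_i,G_i]\,G_i^m$, where $G_i^m$ is the subgroup generated by the $m$-th powers of the elements of $G_i$. The $G_i$ form a nested sequence of normal subgroups of finite index with trivial intersection. Let $X=\bigsqcup_i F_n/G_i$ be the corresponding box space, i.e. the coarse disjoint union of the Cayley graphs of the finite groups $F_n/G_i$ with respect to the images of the free generators: $X$ carries a metric which restricts on each $F_n/G_i$ to the graph metric of its Cayley graph and for which the distance between any two distinct components is greater than the maximum of their diameters. (If $n=0$, so that all components are points, one requires in addition that for every $R$ only finitely many pairs of distinct components are at distance at most $R$; for $n\ge1$ this is automatic.) Such a metric exists, and for every such metric $X$ has bounded geometry (for every $r$ the balls of radius $r$ are finite with uniformly bounded cardinality) and $X$ coarsely embeds into Hilbert space, i.e. there are a map $F:X\to\ell^2$ and non-decreasing functions $\rho_\pm:[0,\infty)\to[0,\infty)$ with $\lim_{t\to\infty}\rho_\pm(t)=\infty$ such that $\rho_-(d(x,x'))\le\|F(x)-F(x')\|\le\rho_+(d(x,x'))$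 for all $x,x'\in X$. If moreover $n\ge2$, then $X$ does not have property A. Here a discrete metric space $X$ of bounded geometry has property A if for all $R,\varepsilon>0$ there are $S>0$ and $\phi:X\to\ell^2(X)$ with $\|\phi(x)\|=1$ and $\operatorname{supp}\phi(x)\subset B_S(x)$ for all $x\in X$, and $|1-\langle\phi(x_1),\phi(x_2)\rangle|\le\varepsilon$ whenever $d(x_1,x_2)\le R$. -/

import Mathlib

open scoped NNReal

/-! ### Coarse geometry of metric spaces -/

/-- `X` coarsely embeds into `Y`: some map `F : X → Y` distorts distances between two non-decreasing
control functions `ρ₋, ρ₊ : ℝ₊ → ℝ₊` which both tend to infinity. -/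
def CoarselyEmbeds (X Y : Type*) [MetricSpace X] [MetricSpace Y] : Prop :=
  ∃ F : X → Y, ∃ ρ₁ ρ₂ : ℝ≥0 → ℝ≥0,
    Monotone ρ₁ ∧ Monotone ρ₂ ∧
    Filter.Tendsto ρ₁ Filter.atTop Filter.atTop ∧
    Filter.Tendsto ρ₂ Filter.atTop Filter.atTop ∧
    ∀ x x' : X, ρ₁ (nndist x x') ≤ nndist (F x) (F x') ∧
      nndist (F x) (F x') ≤ ρ₂ (nndist x x')

/-- Coarse embeddability into the (infinite-dimensional, separable) Hilbert space `ℓ²(ℕ)`. -/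
def CoarselyEmbedsInHilbert (X : Type*) [MetricSpace X] : Prop :=
  CoarselyEmbeds X (lp (fun _ : ℕ => ℝ) 2)

/-- Bounded geometry: for each radius, the balls of this radius are finite, of bounded size. -/
def HasBoundedGeometry (X : Type*) [MetricSpace X] : Prop :=
  ∀ r : ℝ, ∃ N : ℕ, ∀ x : X, (Metric.closedBall x r).encard ≤ N

/-- Property A for a discrete metric space of bounded geometry: for all `R, ε > 0` there are `S > 0`
and a map `φ` into the unit sphere of `ℓ²(X)` that varies by at most `ε` at distance at most `R`,
such that each `φ x` is supported in the ball of radius `S` about `x`. -/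
def HasPropertyA (X : Type*) [MetricSpace X] : Prop :=
  ∀ R : ℝ, 0 < R → ∀ ε : ℝ, 0 < ε →
    ∃ S : ℝ, 0 < S ∧ ∃ φ : X → lp (fun _ : X => ℝ) 2,
      (∀ x, ‖φ x‖ = 1) ∧
      (∀ x₁ x₂, dist x₁ x₂ ≤ R → |1 - inner ℝ (φ x₁) (φ x₂)| ≤ ε) ∧
      (∀ x, Function.support (φ x : X → ℝ) ⊆ Metric.ball x S)

/-! ### Coarse disjoint unions -/

/-- The given metric on `⊔ᵢ Xᵢ` makes it a coarse disjoint union of the bounded metric spaces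
`(Xᵢ, dᵢ)`: it restricts to `dᵢ` on each component, and points of two distinct components are
further apart than any two points of one of these components. By the symmetry of the metric it is
enough to ask the latter for the component of the first point. (For finite components this says
that the distance between two distinct components exceeds both of their diameters.) -/
structure IsCoarseDisjointUnion {ι : Type*} {X : ι → Type*} (d : ∀ i, X i → X i → ℝ)
    [MetricSpace (Σ i, X i)] : Prop where
  dist_same : ∀ (i : ι) (x y : X i), dist (⟨i, x⟩ : Σ i, X i) ⟨i, y⟩ = d i x y
  lt_dist : ∀ i j : ι, i ≠ j → ∀ (x : X i) (y : X j) (u v : X i),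
    d i u v < dist (⟨i, x⟩ : Σ i, X i) ⟨j, y⟩

/-- The distances between distinct components tend to infinity: for each `R`, only finitely many
pairs of distinct components are at distance at most `R`. -/
def ComponentsDiverge {ι : Type*} (X : ι → Type*) [MetricSpace (Σ i, X i)] : Prop :=
  ∀ R : ℝ, {p : ι × ι | p.1 ≠ p.2 ∧
    ∃ (x : X p.1) (y : X p.2), dist (⟨p.1, x⟩ : Σ i, X i) ⟨p.2, y⟩ ≤ R}.Finite

/-! ### The derived `m`-series and box spaces -/

/-- The derived `m`-series `G₁ = G`, `Gᵢ₊₁ = [Gᵢ, Gᵢ] Gᵢᵐ` of a group, where `Gᵢᵐ` is the subgroup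
generated by the `m`-th powers of elements of `Gᵢ`. The indices are shifted by one: the series
starts at index `0`. -/
def derivedMSeries (G : Type*) [Group G] (m : ℕ) : ℕ → Subgroup G
  | 0 => ⊤
  | i + 1 => ⁅derivedMSeries G m i, derivedMSeries G m i⁆ ⊔
      Subgroup.closure ((fun g : G => g ^ m) '' (derivedMSeries G m i : Set G))

instance derivedMSeries_normal (G : Type*) [Group G] (m i : ℕ) :
    (derivedMSeries G m i).Normal := by
  induction i with
  | zero => exact inferInstanceAs (⊤ : Subgroup G).Normal
  | succ i ih =>
    have h : (Subgroup.closure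
        ((fun g : G => g ^ m) '' (derivedMSeries G m i : Set G))).Normal := by
      refine ⟨fun x hx g => ?_⟩
      induction hx using Subgroup.closure_induction with
      | mem x hx =>
        obtain ⟨y, hy, rfl⟩ := hx
        refine Subgroup.subset_closure ⟨g * y * g⁻¹, ih.conj_mem y hy g, ?_⟩
        simp [conj_pow]
      | one => simp
      | mul x y _ _ hx hy => simpa [mul_assoc] using mul_mem hx hy
      | inv x _ hx => simpa [mul_assoc] using inv_mem hx
    exact Subgroup.sup_normal _ _

/-- A sequence of subgroups to which a box space is attached: nested normal subgroups of finite
index with trivial intersection. -/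
structure IsBoxSequence {G : Type*} [Group G] (N : ℕ → Subgroup G) : Prop where
  antitone : Antitone N
  normal : ∀ i, (N i).Normal
  finiteIndex : ∀ i, (N i).FiniteIndex
  iInf_eq_bot : ⨅ i, N i = ⊥

/-- The graph metric on the Cayley graph of `G ⧸ N` with respect to the image of `S ⊆ G`. -/
noncomputable def quotientCayleyDist {G : Type*} [Group G] (S : Set G) (N : Subgroup G) [N.Normal]
    (x y : G ⧸ N) : ℝ :=
  ((SimpleGraph.mulCayley ((QuotientGroup.mk : G → G ⧸ N) '' S)).dist x y : ℝ)

/-- The underlying set `⊔ᵢ Fₙ / Gᵢ` of the box space of the free group `Fₙ` which corresponds to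
its derived `m`-series. -/
abbrev DerivedBoxSpace (n m : ℕ) : Type :=
  Σ i : ℕ, FreeGroup (Fin n) ⧸ derivedMSeries (FreeGroup (Fin n)) m i

/-- The given metric makes the set above the box space: the coarse disjoint union of the Cayley
graphs of the quotients `Fₙ / Gᵢ` with respect to the images of the free generators. -/
def IsDerivedBoxMetric (n m : ℕ) [MetricSpace (DerivedBoxSpace n m)] : Prop :=
  IsCoarseDisjointUnion (fun i : ℕ =>
    quotientCayleyDist (Set.range (FreeGroup.of : Fin n → FreeGroup (Fin n)))
      (derivedMSeries (FreeGroup (Fin n)) m i))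

/-! ### Fox calculus modulo `m` -/

section Fox

open FreeGroup

open scoped Classical

variable {α : Type*}

/-! Fox derivatives modulo `m` count the signed crossings of each edge of the Cayley graph of the
quotient by `N` along the path of a word. By Schreier rewriting, a word in `N` lies in `[N, N] Nᵐ`
exactly when all counts vanish. An element of the next quotient is therefore an endpoint together
with a count vector (`inv_mul_mem_mCommutator_iff`).

If nontrivial elements of `N` have length at least `g`, a reduced word of length at most `g` crosses
distinct edges, so its counts cannot cancel. Hence the shortest relators get longer at every step
(`succ_le_norm_of_mem_mCommutator`), which gives the trivial intersection.

For the embedding, each count is encoded by a basis vector, so that squared distances are twice the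
number of edges with different counts. This number is at most the word distance. Conversely, after a
translation the counts form a unit flow between the two endpoints. If its support has fewer than `g`
edges, it contains no cycle, and the flow is carried by a single path
(`exists_norm_le_card_fox_support`). Word distances are thus recovered exactly up to a scale growing
with the index, which suffices for the union (`coarselyEmbedsInHilbert_of_components`).

Property A would give unit vectors supported in `S`-balls of a component without short relators.
Lifted to the free group and averaged over the component, their squares form an almost invariant
mean (`false_of_almost_equivariant`), which the paradoxical decomposition excludes
(`false_of_almost_invariant`). -/

theorem FreeGroup.induction_letter_right {P : FreeGroup α → Prop} (one : P 1)
    (mul : ∀ g a, P g → P (g * FreeGroup.mk [a])) (g : FreeGroup α) : P g := by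
  obtain ⟨L, rfl⟩ : ∃ L, g = FreeGroup.mk L := by
    classical exact ⟨g.toWord, mk_toWord.symm⟩
  induction L using List.reverseRecOn with
  | nil => exact one
  | append_singleton L a ih => simpa [← FreeGroup.mul_mk] using mul _ a ih

theorem FreeGroup.mk_true (s : α) : FreeGroup.mk [(s, true)] = FreeGroup.of s := rfl

theorem FreeGroup.mk_false (s : α) : FreeGroup.mk [(s, false)] = (FreeGroup.of s)⁻¹ := rfl

/-- The subgroup `[N, N] Nᵐ`. -/
def mCommutator {G : Type*} [Group G] (N : Subgroup G) (m : ℕ) : Subgroup G :=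
  ⁅N, N⁆ ⊔ Subgroup.closure ((fun g : G => g ^ m) '' (N : Set G))

theorem mCommutator_le {G : Type*} [Group G] (N : Subgroup G) (m : ℕ) : mCommutator N m ≤ N := by
  refine sup_le (Subgroup.commutator_le.2 fun a ha b hb => ?_) ((Subgroup.closure_le _).2 ?_)
  · exact N.mul_mem (N.mul_mem (N.mul_mem ha hb) (N.inv_mem ha)) (N.inv_mem hb)
  · rintro _ ⟨g, hg, rfl⟩
    exact N.pow_mem hg m

variable (N : Subgroup (FreeGroup α)) [N.Normal] (m : ℕ)

/-- The unoriented edge of the Cayley graph of the quotient traversed from `u` by the letter `a`,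
recorded as the source and the label of its positively oriented version. -/
noncomputable def edgeAt (u : FreeGroup α ⧸ N) (a : α × Bool) : (FreeGroup α ⧸ N) × α :=
  if a.2 then (u, a.1) else (u * (FreeGroup.mk [a] : FreeGroup α), a.1)

theorem edgeAt_reverse (u : FreeGroup α ⧸ N) (a : α × Bool) :
    edgeAt N (u * (FreeGroup.mk [a] : FreeGroup α)) (a.1, !a.2) = edgeAt N u a := by
  obtain ⟨s, _ | _⟩ := a <;> simp [edgeAt, FreeGroup.mk_true, FreeGroup.mk_false]

theorem edgeAt_left_injective (a : α × Bool) : Function.Injective fun u => edgeAt N u a := by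
  intro u v h
  obtain ⟨s, _ | _⟩ := a <;> simpa [edgeAt] using h

theorem edgeAt_snd (u : FreeGroup α ⧸ N) (a : α × Bool) : (edgeAt N u a).2 = a.1 := by
  unfold edgeAt
  split_ifs <;> rfl

/-- The sign of a letter. -/
def letterSign (a : α × Bool) : ZMod m := if a.2 then 1 else -1

theorem letterSign_ne_zero [Fact (1 < m)] (a : α × Bool) : letterSign m a ≠ 0 := by
  unfold letterSign
  split_ifs <;> simp

variable [DecidableEq α]

/-- The Magnus representation modulo `m`. -/
noncomputable def foxHom : FreeGroup α →*
    ((FreeGroup α ⧸ N) → α → Multiplicative (ZMod m)) ⋊[mulAutArrow] (FreeGroup α ⧸ N) :=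
  FreeGroup.lift fun s => ⟨Pi.mulSingle 1 (Pi.mulSingle s (Multiplicative.ofAdd 1)),
    (FreeGroup.of s : FreeGroup α)⟩

/-- The Fox derivatives modulo `m`: the coefficient at an edge counts how often the path labelled
by a word traverses the edge. -/
noncomputable def fox (g : FreeGroup α) (e : (FreeGroup α ⧸ N) × α) : ZMod m :=
  ((foxHom N m g).left e.1 e.2).toAdd

theorem foxHom_right (g : FreeGroup α) : (foxHom N m g).right = (g : FreeGroup α ⧸ N) := by
  have : SemidirectProduct.rightHom.comp (foxHom N m) = QuotientGroup.mk' N := by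
    ext s
    simp [foxHom]
  exact DFunLike.congr_fun this g

theorem fox_mul (g h : FreeGroup α) (e : (FreeGroup α ⧸ N) × α) :
    fox N m (g * h) e = fox N m g e + fox N m h ((g : FreeGroup α ⧸ N)⁻¹ * e.1, e.2) := by
  simp [fox, foxHom_right]
  rfl

@[simp] theorem fox_one : fox N m 1 = 0 := by
  ext e
  simp [fox]

theorem fox_of (s : α) : fox N m (FreeGroup.of s) = Pi.single (1, s) 1 := by
  ext ⟨u, t⟩
  by_cases hu : u = 1
  · by_cases ht : t = s
    · subst hu ht; simp [fox, foxHom]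
    · subst hu; simp [fox, foxHom, ht]
  · simp [fox, foxHom, hu]

theorem fox_inv (g : FreeGroup α) (e : (FreeGroup α ⧸ N) × α) :
    fox N m g⁻¹ e = - fox N m g ((g : FreeGroup α ⧸ N) * e.1, e.2) := by
  have := fox_mul N m g⁻¹ g e
  simp only [inv_mul_cancel, fox_one, Pi.zero_apply, QuotientGroup.mk_inv, inv_inv] at this
  exact eq_neg_of_add_eq_zero_left this.symm

/-- The product rule moves the derivative of the letter to the vertex reached by `g`. An inverse
letter crosses its edge against the orientation, which accounts for the sign and for the source
recorded by `edgeAt`. -/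
theorem fox_mul_letter (g : FreeGroup α) (a : α × Bool) :
    fox N m (g * FreeGroup.mk [a]) =
      fox N m g + Pi.single (edgeAt N (g : FreeGroup α ⧸ N) a) (letterSign m a) := by
  ext ⟨u, t⟩
  obtain ⟨s, _ | _⟩ := a
  · rw [FreeGroup.mk_false, fox_mul, fox_inv, fox_of]
    simp only [edgeAt, letterSign, FreeGroup.mk_false, Pi.add_apply, Pi.single_apply,
      Prod.mk.injEq, QuotientGroup.mk_inv]
    have : (FreeGroup.of s : FreeGroup α ⧸ N) * ((g : FreeGroup α ⧸ N)⁻¹ * u) = 1 ↔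
        u = (g : FreeGroup α ⧸ N) * (FreeGroup.of s : FreeGroup α ⧸ N)⁻¹ := by
      rw [mul_eq_one_iff_eq_inv', inv_mul_eq_iff_eq_mul]
    simp only [this]
    split_ifs <;> simp_all
  · rw [FreeGroup.mk_true, fox_mul, fox_of]
    simp only [edgeAt, letterSign, Pi.add_apply, Pi.single_apply, Prod.mk.injEq]
    have : (g : FreeGroup α ⧸ N)⁻¹ * u = 1 ↔ u = (g : FreeGroup α ⧸ N) := by
      rw [inv_mul_eq_iff_eq_mul, mul_one]
    simp only [this]
    split_ifs <;> simp_all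

theorem fox_mul_of_mem {g : FreeGroup α} (hg : g ∈ N) (h : FreeGroup α) :
    fox N m (g * h) = fox N m g + fox N m h := by
  ext e
  rw [fox_mul, (QuotientGroup.eq_one_iff g).2 hg]
  simp

/-- The Fox derivatives, as a homomorphism on the normal subgroup. -/
noncomputable def foxRestrict : N →* Multiplicative ((FreeGroup α ⧸ N) × α → ZMod m) where
  toFun g := Multiplicative.ofAdd (fox N m g)
  map_one' := by simp
  map_mul' g h := by
    rw [← ofAdd_add, ← fox_mul_of_mem N m g.2]
    rfl

theorem mCommutator_le_ker_fox :
    mCommutator N m ≤ (foxRestrict N m).ker.map N.subtype := by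
  refine sup_le (Subgroup.commutator_le.2 fun a ha b hb => ?_) ((Subgroup.closure_le _).2 ?_)
  · refine ⟨⟨a, ha⟩ * ⟨b, hb⟩ * ⟨a, ha⟩⁻¹ * ⟨b, hb⟩⁻¹, ?_, rfl⟩
    rw [SetLike.mem_coe, MonoidHom.mem_ker, _root_.map_mul, _root_.map_mul, _root_.map_mul,
      _root_.map_inv, _root_.map_inv, mul_inv_cancel_comm, mul_inv_cancel]
  · rintro _ ⟨g, hg, rfl⟩
    refine ⟨⟨g, hg⟩ ^ m, ?_, rfl⟩
    simp only [SetLike.mem_coe, MonoidHom.mem_ker, map_pow]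
    apply Multiplicative.toAdd.injective
    ext e
    simp

theorem fox_eq_zero_of_mem_mCommutator {g : FreeGroup α} (hg : g ∈ mCommutator N m) :
    fox N m g = 0 := by
  obtain ⟨h, hh, rfl⟩ := mCommutator_le_ker_fox N m hg
  exact Multiplicative.ofAdd.injective hh

/-- Schreier rewriting: with a transversal `t`, each edge yields an element of `N`, and `N` modulo
`[N, N] Nᵐ` is a `ZMod m`-module. The class of a word in `N` is the sum of its edge classes weighted
by the Fox coefficients. -/
theorem mem_mCommutator_of_fox_eq_zero [Fintype α] [Fintype (FreeGroup α ⧸ N)]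
    {g : FreeGroup α} (hg : g ∈ N) (h0 : fox N m g = 0) : g ∈ mCommutator N m := by
  set M := mCommutator N m with hM
  have hsub : ∀ a b : N, a * b * a⁻¹ * b⁻¹ ∈ M.subgroupOf N := fun a b =>
    Subgroup.mem_sup_left (Subgroup.commutator_mem_commutator a.2 b.2)
  have : (M.subgroupOf N).Normal := ⟨fun x hx a => by
    have := (M.subgroupOf N).mul_mem (hsub a x) hx
    simpa using this⟩
  let : CommGroup (N ⧸ M.subgroupOf N) :=
    { (inferInstance : Group (N ⧸ M.subgroupOf N)) with
      mul_comm := by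
        rintro ⟨a⟩ ⟨b⟩
        refine QuotientGroup.eq.2 ?_
        have := hsub b⁻¹ a⁻¹
        simpa [mul_assoc] using this }
  let : Module (ZMod m) (Additive (N ⧸ M.subgroupOf N)) := AddCommGroup.zmodModule (by
    rintro ⟨x⟩
    refine (QuotientGroup.eq_one_iff (N := M.subgroupOf N) (x ^ m)).2 ?_
    exact Subgroup.mem_sup_right (Subgroup.subset_closure ⟨x, x.2, rfl⟩))
  let t : FreeGroup α ⧸ N → FreeGroup α := Quotient.out
  have ht : ∀ u, ((t u : FreeGroup α) : FreeGroup α ⧸ N) = u := fun u => Quotient.out_eq _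
  have hγ : ∀ (u : FreeGroup α ⧸ N) (g : FreeGroup α),
      t u * g * (t (u * (g : FreeGroup α ⧸ N)))⁻¹ ∈ N := fun u g => by
    rw [← QuotientGroup.eq_one_iff]
    simp [ht]
  -- The Schreier cocycle; its values on the generators are the classes of the edges.
  let γ : FreeGroup α ⧸ N → FreeGroup α → Additive (N ⧸ M.subgroupOf N) := fun u g =>
    Additive.ofMul (QuotientGroup.mk (⟨_, hγ u g⟩ : N))
  have hγmul : ∀ u g h, γ u (g * h) = γ u g + γ (u * (g : FreeGroup α ⧸ N)) h := fun u g h => by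
    refine congrArg (fun x : N => Additive.ofMul (QuotientGroup.mk x : N ⧸ M.subgroupOf N))
      (Subtype.ext ?_)
    simp [mul_assoc]
  have hγone : ∀ u, γ u 1 = 0 := fun u => by
    have := hγmul u 1 1
    simpa using this
  have key : ∀ g, γ 1 g = ∑ e, fox N m g e • γ e.1 (FreeGroup.of e.2) := fun g => by
    induction g using FreeGroup.induction_letter_right with
    | one => simp [hγone]
    | mul g a ih =>
      rw [hγmul, ih, fox_mul_letter]
      simp only [Pi.add_apply, add_smul, Finset.sum_add_distrib, add_right_inj, one_mul,
        Pi.single_apply, ite_smul, zero_smul, Finset.sum_ite_eq', Finset.mem_univ, if_true]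
      obtain ⟨s, _ | _⟩ := a
      · have := hγmul ((g : FreeGroup α ⧸ N) * (FreeGroup.of s : FreeGroup α ⧸ N)⁻¹)
          (FreeGroup.of s) (FreeGroup.of s)⁻¹
        simp only [mul_inv_cancel, hγone, inv_mul_cancel_right] at this
        simp only [edgeAt, letterSign, FreeGroup.mk_false, QuotientGroup.mk_inv]
        simpa using (eq_neg_of_add_eq_zero_right this.symm)
      · simp [edgeAt, letterSign, FreeGroup.mk_true]
  have h1 : γ 1 g = 0 := by simp [key, h0]
  have h2 : γ 1 g = Additive.ofMul (QuotientGroup.mk (⟨g, hg⟩ : N)) := by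
    -- The representative `t 1` need not be `1`, so `γ 1 g` is the class of a conjugate of `g`;
    -- conjugation is harmless in the abelian quotient.
    have ht1 : t 1 ∈ N := (QuotientGroup.eq_one_iff _).1 (ht 1)
    have : γ 1 g = Additive.ofMul
        (QuotientGroup.mk (⟨t 1, ht1⟩ * ⟨g, hg⟩ * ⟨t 1, ht1⟩⁻¹ : N) : N ⧸ M.subgroupOf N) := by
      refine congrArg (fun x : N => Additive.ofMul (QuotientGroup.mk x : N ⧸ M.subgroupOf N))
        (Subtype.ext ?_)
      simp [(QuotientGroup.eq_one_iff g).2 hg]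
    rw [this, QuotientGroup.mk_mul, QuotientGroup.mk_mul, QuotientGroup.mk_inv,
      mul_inv_cancel_comm]
  rw [h2] at h1
  exact (QuotientGroup.eq_one_iff (N := M.subgroupOf N) (⟨g, hg⟩ : N)).1 h1

theorem inv_mul_mem_mCommutator_iff [Fintype α] [Fintype (FreeGroup α ⧸ N)] (g h : FreeGroup α) :
    g⁻¹ * h ∈ mCommutator N m ↔
      (g : FreeGroup α ⧸ N) = (h : FreeGroup α ⧸ N) ∧ fox N m g = fox N m h := by
  have hh : fox N m h = fun e => fox N m g e +
      fox N m (g⁻¹ * h) ((g : FreeGroup α ⧸ N)⁻¹ * e.1, e.2) := by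
    ext e
    rw [← fox_mul, mul_inv_cancel_left]
  constructor
  · intro hm
    refine ⟨QuotientGroup.eq.2 (mCommutator_le N m hm), ?_⟩
    rw [hh, fox_eq_zero_of_mem_mCommutator N m hm]
    simp
  · rintro ⟨hq, hf⟩
    refine mem_mCommutator_of_fox_eq_zero N m (QuotientGroup.eq.1 hq) ?_
    ext e
    have := congrFun hh ((g : FreeGroup α ⧸ N) * e.1, e.2)
    rw [hf] at this
    simpa using this

theorem finite_quotient_mCommutator [Finite α] [NeZero m] [Finite (FreeGroup α ⧸ N)] :
    Finite (FreeGroup α ⧸ mCommutator N m) := by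
  have := Fintype.ofFinite α
  have := Fintype.ofFinite (FreeGroup α ⧸ N)
  refine Finite.of_injective (β := (FreeGroup α ⧸ N) × ((FreeGroup α ⧸ N) × α → ZMod m))
    (fun x => ((Quotient.out x : FreeGroup α), fox N m (Quotient.out x))) fun x y hxy => ?_
  rw [Prod.mk.injEq, ← inv_mul_mem_mCommutator_iff] at hxy
  rw [← Quotient.out_eq x, ← Quotient.out_eq y]
  exact QuotientGroup.eq.2 hxy

end Fox

/-! ### Short loops in quotients of free groups -/

section Loops

open FreeGroup

open scoped Classical

variable {α : Type*} (N : Subgroup (FreeGroup α)) [N.Normal] (m : ℕ)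

/-- The vertex reached from `u` along the first `j` letters of `L`. -/
def vertexAt (u : FreeGroup α ⧸ N) (L : List (α × Bool)) (j : ℕ) : FreeGroup α ⧸ N :=
  u * (FreeGroup.mk (L.take j) : FreeGroup α)

theorem vertexAt_append (u : FreeGroup α ⧸ N) (L L' : List (α × Bool)) {j : ℕ}
    (hj : j ≤ L.length) : vertexAt N u (L ++ L') j = vertexAt N u L j := by
  simp [vertexAt, List.take_append_of_le_length hj]

theorem vertexAt_length (u : FreeGroup α ⧸ N) (L : List (α × Bool)) :
    vertexAt N u L L.length = u * (FreeGroup.mk L : FreeGroup α) := by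
  simp [vertexAt]

theorem vertexAt_succ (u : FreeGroup α ⧸ N) (L : List (α × Bool)) {j : ℕ} (hj : j < L.length) :
    vertexAt N u L (j + 1) = vertexAt N u L j * (FreeGroup.mk [L[j]] : FreeGroup α) := by
  rw [vertexAt, vertexAt, List.take_succ_eq_append_getElem hj, ← FreeGroup.mul_mk,
    QuotientGroup.mk_mul, mul_assoc]

/-! ### Flows on the Cayley graph modulo `m` -/

section Flow

variable {N} [Fintype α]

/-- The net flow out of a vertex. -/
noncomputable def outflow (τ : (FreeGroup α ⧸ N) × α → ZMod m) (v : FreeGroup α ⧸ N) : ZMod m :=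
  ∑ a : α × Bool, letterSign m a * τ (edgeAt N v a)

theorem outflow_add (τ τ' : (FreeGroup α ⧸ N) × α → ZMod m) (v : FreeGroup α ⧸ N) :
    outflow m (τ + τ') v = outflow m τ v + outflow m τ' v := by
  simp [outflow, mul_add, Finset.sum_add_distrib]

theorem outflow_sub (τ τ' : (FreeGroup α ⧸ N) × α → ZMod m) (v : FreeGroup α ⧸ N) :
    outflow m (τ - τ') v = outflow m τ v - outflow m τ' v := by
  simp [outflow, mul_sub, Finset.sum_sub_distrib]

theorem exists_edgeAt_ne_zero_of_outflow_ne_zero {τ : (FreeGroup α ⧸ N) × α → ZMod m}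
    {v : FreeGroup α ⧸ N} (h : outflow m τ v ≠ 0) : ∃ a, τ (edgeAt N v a) ≠ 0 := by
  obtain ⟨a, -, ha⟩ := Finset.exists_ne_zero_of_sum_ne_zero h
  exact ⟨a, right_ne_zero_of_mul ha⟩

theorem exists_edgeAt_ne_zero_of_outflow_eq_zero [Fact (1 < m)]
    {τ : (FreeGroup α ⧸ N) × α → ZMod m} {v : FreeGroup α ⧸ N} (h : outflow m τ v = 0)
    {b : α × Bool} (hb : τ (edgeAt N v b) ≠ 0) : ∃ a ≠ b, τ (edgeAt N v a) ≠ 0 := by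
  by_contra! hno
  rw [outflow, Fintype.sum_eq_single b fun a ha => by rw [hno a ha, mul_zero]] at h
  unfold letterSign at h
  split_ifs at h <;> simp [hb] at h

/-- Conservation at the endpoint prevents the edge just used from being the only one there carrying
flow, so the path can leave by another letter without backtracking. -/
theorem exists_isReduced_append [Fact (1 < m)] {τ : (FreeGroup α ⧸ N) × α → ZMod m}
    {u : FreeGroup α ⧸ N} {L : List (α × Bool)} (hL : IsReduced L) (hne : L ≠ [])
    (hLτ : ∀ j : Fin L.length, τ (edgeAt N (vertexAt N u L j) L[j]) ≠ 0)
    (h : outflow m τ (u * (FreeGroup.mk L : FreeGroup α)) = 0) :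
    ∃ a, IsReduced (L ++ [a]) ∧ τ (edgeAt N (u * (FreeGroup.mk L : FreeGroup α)) a) ≠ 0 := by
  rcases List.eq_nil_or_concat' L with rfl | ⟨L, b, rfl⟩
  · exact absurd rfl hne
  have h1 := hLτ ⟨L.length, by simp⟩
  simp only [Fin.getElem_fin, vertexAt_append N u L [b] le_rfl, vertexAt_length] at h1
  -- Seen from the endpoint, the last edge is left by the reverse of the letter `b`.
  rw [← edgeAt_reverse, mul_assoc, ← QuotientGroup.mk_mul] at h1
  simp only [FreeGroup.mul_mk, List.getElem_concat_length] at h1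
  obtain ⟨a, ha, ha'⟩ := exists_edgeAt_ne_zero_of_outflow_eq_zero m h h1
  refine ⟨a, hL.append_overlap ?_ (by simp), ha'⟩
  simp only [List.cons_append, List.nil_append, isReduced_cons_cons, IsReduced.singleton, and_true]
  intro hab
  by_contra hne
  refine ha (Prod.ext hab.symm ?_)
  cases h4 : a.2 <;> cases h5 : b.2 <;> simp_all

end Flow

/-! ### Reduced paths and large girth -/

variable [DecidableEq α]

theorem exists_mem_norm_le_of_vertexAt_eq {L : List (α × Bool)} (hL : IsReduced L)
    (u : FreeGroup α ⧸ N) {j k : ℕ} (hjk : j < k) (hk : k ≤ L.length)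
    (h : vertexAt N u L j = vertexAt N u L k) : ∃ w ∈ N, w ≠ 1 ∧ norm w ≤ k - j := by
  refine ⟨FreeGroup.mk ((L.take k).drop j), ?_, ?_, ?_⟩
  · have : L.take k = L.take j ++ (L.take k).drop j := by
      conv_lhs => rw [← List.take_append_drop j (L.take k)]
      rw [List.take_take, min_eq_left hjk.le]
    rw [vertexAt, vertexAt, this, ← FreeGroup.mul_mk, QuotientGroup.mk_mul, mul_right_inj,
      eq_comm, mul_eq_left] at h
    exact (QuotientGroup.eq_one_iff _).1 h
  · have hr : IsReduced ((L.take k).drop j) :=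
      (hL.infix (List.take_prefix k L).isInfix).infix (List.drop_suffix j _).isInfix
    rw [ne_eq, ← FreeGroup.toWord_eq_nil_iff, FreeGroup.toWord_mk, hr.reduce_eq,
      ← List.length_eq_zero_iff]
    simp
    omega
  · refine norm_mk_le.trans ?_
    rw [List.length_drop, List.length_take]
    omega

/-- Two crossings in the same direction start at the same vertex. For opposite directions, the path
is at the end of the first crossing again when the second begins; reducedness makes the loop in
between nonempty. -/
theorem exists_mem_norm_le_of_edgeAt_eq {L : List (α × Bool)} (hL : IsReduced L)
    (u : FreeGroup α ⧸ N) {j k : ℕ} (hjk : j < k) (hk : k < L.length)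
    (h : edgeAt N (vertexAt N u L j) L[j] = edgeAt N (vertexAt N u L k) L[k]) :
    ∃ w ∈ N, w ≠ 1 ∧ norm w ≤ k - j := by
  have h1 : L[j].1 = L[k].1 := by
    rw [← edgeAt_snd N (vertexAt N u L j), h, edgeAt_snd]
  by_cases h2 : L[j].2 = L[k].2
  · rw [Prod.ext h1 h2] at h
    exact exists_mem_norm_le_of_vertexAt_eq N hL u hjk hk.le (edgeAt_left_injective N _ h)
  · have h3 : L[k] = (L[j].1, !L[j].2) := by
      refine Prod.ext h1.symm ?_
      cases h4 : L[j].2 <;> cases h5 : L[k].2 <;> simp_all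
    rw [← edgeAt_reverse N _ L[j], ← vertexAt_succ N u L (hjk.trans hk), h3] at h
    have h4 := edgeAt_left_injective N _ h
    have h5 : j + 1 < k := by
      refine lt_of_le_of_ne hjk fun h5 => ?_
      subst h5
      exact h2 (List.isChain_iff_getElem.1 hL j hk h1)
    obtain ⟨w, hw, hw1, hw2⟩ := exists_mem_norm_le_of_vertexAt_eq N hL u h5 hk.le h4
    exact ⟨w, hw, hw1, by omega⟩

variable {N} {g : ℕ}

theorem edgeAt_injOn_of_length_le (hg : ∀ w ∈ N, w ≠ 1 → g ≤ norm w) {L : List (α × Bool)}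
    (hL : IsReduced L) (hlen : L.length ≤ g) (u : FreeGroup α ⧸ N) :
    Function.Injective fun j : Fin L.length => edgeAt N (vertexAt N u L j) L[j] := by
  have key : ∀ j k : Fin L.length, j < k →
      edgeAt N (vertexAt N u L j) L[j] ≠ edgeAt N (vertexAt N u L k) L[k] := fun j k hjk h => by
    obtain ⟨w, hw, hw1, hw2⟩ := exists_mem_norm_le_of_edgeAt_eq N hL u hjk k.2 h
    have := hg w hw hw1
    omega
  intro j k h
  by_contra hne
  rcases lt_or_gt_of_ne hne with h' | h'
  · exact key j k h' h
  · exact key k j h' h.symm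

theorem exists_edgeAt_of_fox_ne_zero (L : List (α × Bool)) {e : (FreeGroup α ⧸ N) × α}
    (he : fox N m (FreeGroup.mk L) e ≠ 0) :
    ∃ j : Fin L.length, e = edgeAt N (vertexAt N 1 L j) L[j] := by
  induction L using List.reverseRecOn with
  | nil => exact absurd (congrFun (fox_one N m) e) he
  | append_singleton L a ih =>
    rw [← FreeGroup.mul_mk, fox_mul_letter, Pi.add_apply] at he
    by_cases h0 : fox N m (FreeGroup.mk L) e = 0
    · rw [h0, zero_add] at he
      refine ⟨⟨L.length, by simp⟩, ?_⟩
      by_contra hne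
      refine he (Pi.single_eq_of_ne (fun h => hne ?_) _)
      simp [h, vertexAt]
    · obtain ⟨j, rfl⟩ := ih h0
      refine ⟨⟨j, by simp only [List.length_append]; omega⟩, ?_⟩
      simp [vertexAt_append N 1 L [a] j.2.le]

theorem card_fox_support_le [Fintype α] [Fintype (FreeGroup α ⧸ N)] (w : FreeGroup α) :
    (Finset.univ.filter fun e => fox N m w e ≠ 0).card ≤ norm w := by
  have hsub : (Finset.univ.filter fun e => fox N m w e ≠ 0) ⊆
      Finset.univ.image fun j : Fin w.toWord.length =>
        edgeAt N (vertexAt N 1 w.toWord j) w.toWord[j] := fun e he => by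
    rw [Finset.mem_filter, ← FreeGroup.mk_toWord (x := w)] at he
    obtain ⟨j, hj⟩ := exists_edgeAt_of_fox_ne_zero m _ he.2
    exact Finset.mem_image.2 ⟨j, Finset.mem_univ _, hj.symm⟩
  refine (Finset.card_le_card hsub).trans (Finset.card_image_le.trans ?_)
  simp [FreeGroup.norm]

/-- At length exactly `g` all edges of the path are still distinct, so the contribution of the last
letter cannot be cancelled by the earlier ones. -/
theorem succ_le_norm_of_mem_mCommutator [Fact (1 < m)] (hg : ∀ w ∈ N, w ≠ 1 → g ≤ norm w)
    {w : FreeGroup α} (hw : w ∈ mCommutator N m) (hw1 : w ≠ 1) : g + 1 ≤ norm w := by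
  refine Nat.lt_of_le_of_ne (hg w (mCommutator_le N m hw) hw1) fun hlen => ?_
  rcases List.eq_nil_or_concat' w.toWord with h | ⟨L, a, hLa⟩
  · exact hw1 (toWord_eq_nil_iff.1 h)
  have hred : IsReduced (L ++ [a]) := hLa ▸ isReduced_toWord
  have hlen' : (L ++ [a]).length ≤ g := by rw [← hLa, hlen]; rfl
  have h0 := congrFun (fox_eq_zero_of_mem_mCommutator N m hw)
    (edgeAt N (FreeGroup.mk L : FreeGroup α) a)
  rw [← FreeGroup.mk_toWord (x := w), hLa, ← FreeGroup.mul_mk, fox_mul_letter, Pi.add_apply,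
    Pi.single_eq_same] at h0
  have h1 : fox N m (FreeGroup.mk L) (edgeAt N (FreeGroup.mk L : FreeGroup α) a) ≠ 0 := fun h => by
    rw [h, zero_add] at h0
    exact letterSign_ne_zero m a h0
  obtain ⟨j, hj⟩ := exists_edgeAt_of_fox_ne_zero m L h1
  have := edgeAt_injOn_of_length_le hg hred hlen' 1
    (a₁ := ⟨j, by simp only [List.length_append]; omega⟩) (a₂ := ⟨L.length, by simp⟩) (by
      simp only [Fin.getElem_fin, vertexAt_append N 1 L [a] j.2.le, vertexAt_append N 1 L [a] le_rfl,
        vertexAt_length]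
      simpa using hj.symm)
  simp only [Fin.mk.injEq] at this
  omega

/-- A reduced path which may be prolonged within a small set of edges unless it has reached its
goal does reach its goal. -/
theorem exists_reduced_path (hg : ∀ w ∈ N, w ≠ 1 → g ≤ norm w)
    (T : Finset ((FreeGroup α ⧸ N) × α)) (hT : T.card < g) (u : FreeGroup α ⧸ N)
    (goal : FreeGroup α ⧸ N → Prop)
    (hext : ∀ L : List (α × Bool), IsReduced L → L.length ≤ T.card →
      (∀ j : Fin L.length, edgeAt N (vertexAt N u L j) L[j] ∈ T) →
      ¬ goal (u * (FreeGroup.mk L : FreeGroup α)) →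
      ∃ a, IsReduced (L ++ [a]) ∧ edgeAt N (u * (FreeGroup.mk L : FreeGroup α)) a ∈ T) :
    ∃ L : List (α × Bool), L.length ≤ T.card ∧
      (∀ j : Fin L.length, edgeAt N (vertexAt N u L j) L[j] ∈ T) ∧
      goal (u * (FreeGroup.mk L : FreeGroup α)) := by
  by_contra! hno
  -- If the goal were never reached, the path could grow to `T.card + 1 ≤ g` letters; its edges
  -- would be distinct elements of `T`, against the pigeonhole principle.
  have key : ∀ k ≤ T.card + 1, ∃ L : List (α × Bool), IsReduced L ∧ L.length = k ∧
      ∀ j : Fin L.length, edgeAt N (vertexAt N u L j) L[j] ∈ T := by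
    intro k hk
    induction k with
    | zero => exact ⟨[], IsReduced.nil, rfl, fun j => j.elim0⟩
    | succ k ih =>
      obtain ⟨L, hL, rfl, hLT⟩ := ih (by omega)
      obtain ⟨a, ha, haT⟩ := hext L hL (by omega) hLT (hno L (by omega) hLT)
      refine ⟨L ++ [a], ha, by simp, fun ⟨j, hj⟩ => ?_⟩
      rcases Nat.lt_or_ge j L.length with h | h
      · simpa [vertexAt_append N u L [a] h.le, h] using hLT ⟨j, h⟩
      · obtain rfl : j = L.length := by simp at hj; omega
        simpa [vertexAt_append N u L [a] le_rfl, vertexAt_length] using haT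
  obtain ⟨L, hL, hlen, hLT⟩ := key _ le_rfl
  have := Finset.card_le_card_of_injOn (s := Finset.univ) (t := T)
    (fun j : Fin L.length => edgeAt N (vertexAt N u L j) L[j]) (fun j _ => hLT j)
    ((edgeAt_injOn_of_length_le hg hL (by omega) u).injOn)
  simp at this
  omega

/-! ### Flows with support smaller than the girth -/

variable [Fintype α]

theorem outflow_single (u v : FreeGroup α ⧸ N) (a : α × Bool) {w : FreeGroup α ⧸ N}
    (hw : w = u * (FreeGroup.mk [a] : FreeGroup α)) :
    outflow m (Pi.single (edgeAt N u a) (letterSign m a)) v =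
      (if v = u then 1 else 0) - if v = w then 1 else 0 := by
  have hsum : ∀ (p : Prop) [Decidable p] (s : α) (x : ZMod m),
      ∑ t : α, (if p ∧ t = s then x else 0) = if p then x else 0 := fun p _ s x => by
    by_cases hp : p <;> simp [hp]
  obtain ⟨s, _ | _⟩ := a <;>
  simp only [outflow, Fintype.sum_prod_type, Fintype.sum_bool, letterSign, edgeAt,
    FreeGroup.mk_true, FreeGroup.mk_false, Pi.single_apply, Prod.mk.injEq, if_true,
    Bool.false_eq_true, if_false, one_mul, neg_one_mul, Finset.sum_add_distrib,
    Finset.sum_neg_distrib, hsum, QuotientGroup.mk_inv] at hw ⊢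
  · have : ∑ t : α, (if v * (FreeGroup.of t : FreeGroup α ⧸ N)⁻¹ =
        u * (FreeGroup.of s : FreeGroup α ⧸ N)⁻¹ ∧ t = s then (-1 : ZMod m) else 0) =
        if v = u then -1 else 0 := by
      rw [← hsum (v = u) s]
      refine Finset.sum_congr rfl fun t _ => if_congr ?_ rfl rfl
      constructor <;> rintro ⟨h, rfl⟩ <;> simpa using h
    rw [this]
    simp only [← hw]
    split_ifs <;> simp
  · have : ∑ t : α, (if v * (FreeGroup.of t : FreeGroup α ⧸ N)⁻¹ = u ∧ t = s
        then (1 : ZMod m) else 0) = if v = u * (FreeGroup.of s : FreeGroup α ⧸ N) then 1 else 0 := by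
      rw [← hsum (v = _) s]
      refine Finset.sum_congr rfl fun t _ => if_congr ?_ rfl rfl
      constructor <;> rintro ⟨h, rfl⟩ <;> simpa [mul_inv_eq_iff_eq_mul] using h
    rw [this]
    simp only [← hw]
    split_ifs <;> simp

/-- Kirchhoff's law: the path of `w` carries one unit from `1` to its endpoint, and the
contributions at intermediate vertices telescope. -/
theorem outflow_fox (w : FreeGroup α) (v : FreeGroup α ⧸ N) :
    outflow m (fox N m w) v = (if v = 1 then 1 else 0) - if v = w then 1 else 0 := by
  induction w using FreeGroup.induction_letter_right with
  | one => simp [outflow]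
  | mul w a ih =>
    rw [fox_mul_letter, outflow_add, ih, outflow_single m _ _ _ (QuotientGroup.mk_mul N w _)]
    ring

variable [Fintype (FreeGroup α ⧸ N)]

/-- The support of a circulation has no leaves, so a reduced path inside it could be prolonged
forever. The unreachable goal `False` expresses this. -/
theorem eq_zero_of_outflow_eq_zero [Fact (1 < m)] (hg : ∀ w ∈ N, w ≠ 1 → g ≤ norm w)
    {τ : (FreeGroup α ⧸ N) × α → ZMod m} (hτ : ∀ v, outflow m τ v = 0)
    (hcard : (Finset.univ.filter fun e => τ e ≠ 0).card < g) : τ = 0 := by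
  by_contra hne
  obtain ⟨e, he⟩ := Function.ne_iff.1 hne
  obtain ⟨L, -, -, hL⟩ := exists_reduced_path hg _ hcard e.1 (fun _ => False)
    (fun L hL _ hLT _ => by
      simp only [Finset.mem_filter, Finset.mem_univ, true_and] at hLT ⊢
      by_cases hnil : L = []
      · subst hnil
        refine ⟨(e.2, true), IsReduced.singleton, ?_⟩
        simpa [edgeAt, ← FreeGroup.one_eq_mk] using he
      · exact exists_isReduced_append m hL hnil hLT (hτ _))
  exact hL

/-- A reduced path from `1` that follows the support of the flow of `x` can only stop at `x`.
Subtracting the flow of this path leaves a circulation in the same support, which vanishes. So path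
and `x` have equal endpoints and equal Fox derivatives. -/
theorem exists_norm_le_card_fox_support [Fact (1 < m)] (hg : ∀ w ∈ N, w ≠ 1 → g ≤ norm w)
    (x : FreeGroup α) (hcard : (Finset.univ.filter fun e => fox N m x e ≠ 0).card < g) :
    ∃ w : FreeGroup α, norm w ≤ (Finset.univ.filter fun e => fox N m x e ≠ 0).card ∧
      x⁻¹ * w ∈ mCommutator N m := by
  obtain ⟨L, hlen, hLT, hgoal⟩ := exists_reduced_path hg _ hcard 1 (fun v => v = x)
    (fun L hL hlen hLT hne => by
      simp only [Finset.mem_filter, Finset.mem_univ, true_and] at hLT ⊢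
      by_cases hnil : L = []
      · subst hnil
        rw [← FreeGroup.one_eq_mk, QuotientGroup.mk_one, mul_one] at hne ⊢
        obtain ⟨a, ha⟩ := exists_edgeAt_ne_zero_of_outflow_ne_zero m (τ := fox N m x) (v := 1) (by
          rw [outflow_fox, if_pos rfl, if_neg hne]
          simp)
        exact ⟨a, IsReduced.singleton, ha⟩
      · refine exists_isReduced_append m hL hnil hLT ?_
        rw [outflow_fox, if_neg hne, if_neg, sub_zero]
        intro h1
        -- The source `1` is not revisited, since the path is shorter than the girth; the flow is
        -- therefore conserved at the current endpoint.
        obtain ⟨w, hw, hw1, hw2⟩ := exists_mem_norm_le_of_vertexAt_eq N hL 1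
          (List.length_pos_iff.2 hnil) le_rfl (by
            rw [vertexAt_length, h1]
            simp [vertexAt, ← FreeGroup.one_eq_mk])
        have := hg w hw hw1
        omega)
  refine ⟨FreeGroup.mk L, norm_mk_le.trans hlen, ?_⟩
  rw [one_mul] at hgoal
  rw [inv_mul_mem_mCommutator_iff]
  refine ⟨hgoal.symm, sub_eq_zero.1 (eq_zero_of_outflow_eq_zero m hg (fun v => ?_)
    (lt_of_le_of_lt (Finset.card_le_card fun e he => ?_) hcard))⟩
  · rw [outflow_sub, outflow_fox, outflow_fox, hgoal, sub_self]
  · simp only [Finset.mem_filter, Finset.mem_univ, true_and, Pi.sub_apply] at he hLT ⊢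
    intro h0
    rw [h0, zero_sub, neg_ne_zero] at he
    obtain ⟨j, rfl⟩ := exists_edgeAt_of_fox_ne_zero m L he
    exact hLT j h0

end Loops

/-! ### Word metrics on quotients of free groups -/

section Cayley

variable {α : Type*} (N : Subgroup (FreeGroup α)) [N.Normal]

/-- The Cayley graph of a quotient of a free group with respect to the free generators. -/
abbrev quotientCayley : SimpleGraph (FreeGroup α ⧸ N) :=
  SimpleGraph.mulCayley ((QuotientGroup.mk : FreeGroup α → FreeGroup α ⧸ N) ''
    Set.range (FreeGroup.of : α → FreeGroup α))

theorem quotientCayley_adj_mul_letter (x : FreeGroup α ⧸ N) (a : α × Bool)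
    (hne : x ≠ x * (FreeGroup.mk [a] : FreeGroup α)) :
    (quotientCayley N).Adj x (x * (FreeGroup.mk [a] : FreeGroup α)) := by
  rw [SimpleGraph.mulCayley_adj']
  refine ⟨hne, FreeGroup.of a.1, ⟨_, ⟨a.1, rfl⟩, rfl⟩, ?_⟩
  obtain ⟨s, _ | _⟩ := a
  · right
    simp [FreeGroup.mk_false]
  · left
    simp [FreeGroup.mk_true]

theorem exists_letter_of_quotientCayley_adj {x y : FreeGroup α ⧸ N}
    (h : (quotientCayley N).Adj x y) :
    ∃ a : α × Bool, x * (FreeGroup.mk [a] : FreeGroup α) = y := by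
  rw [SimpleGraph.mulCayley_adj'] at h
  obtain ⟨-, _, ⟨_, ⟨s, rfl⟩, rfl⟩, h | h⟩ := h
  · exact ⟨(s, true), h⟩
  · refine ⟨(s, false), ?_⟩
    rw [h]
    simp [FreeGroup.mk_false]

/-- A letter that is trivial in the quotient would be a loop, absent from a simple graph; it is
skipped, whence only an inequality. -/
theorem exists_walk_length_le (L : List (α × Bool)) (x : FreeGroup α ⧸ N) :
    ∃ p : (quotientCayley N).Walk x (x * (FreeGroup.mk L : FreeGroup α)),
      p.length ≤ L.length := by
  induction L generalizing x with
  | nil => exact ⟨SimpleGraph.Walk.nil.copy rfl (by simp [← FreeGroup.one_eq_mk]), by simp⟩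
  | cons a L ih =>
    obtain ⟨p, hp⟩ := ih (x * (FreeGroup.mk [a] : FreeGroup α))
    have hend : x * (FreeGroup.mk [a] : FreeGroup α) * (FreeGroup.mk L : FreeGroup α) =
        x * (FreeGroup.mk (a :: L) : FreeGroup α) := by
      rw [mul_assoc, ← QuotientGroup.mk_mul, FreeGroup.mul_mk]
      rfl
    by_cases hne : x = x * (FreeGroup.mk [a] : FreeGroup α)
    · exact ⟨p.copy hne.symm hend, by simpa using hp.trans (Nat.le_succ _)⟩
    · exact ⟨(p.cons (quotientCayley_adj_mul_letter N x a hne)).copy rfl hend, by simpa using hp⟩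

variable [DecidableEq α]

theorem exists_norm_le_of_walk {x y : FreeGroup α ⧸ N} (p : (quotientCayley N).Walk x y) :
    ∃ w : FreeGroup α, w.norm ≤ p.length ∧ x * (w : FreeGroup α ⧸ N) = y := by
  induction p with
  | nil => exact ⟨1, by simp⟩
  | cons h p ih =>
    obtain ⟨a, rfl⟩ := exists_letter_of_quotientCayley_adj N h
    obtain ⟨w, hw, rfl⟩ := ih
    refine ⟨FreeGroup.mk [a] * w, ?_, by simp [mul_assoc]⟩
    have h1 : (FreeGroup.mk [a]).norm ≤ 1 := FreeGroup.norm_mk_le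
    have h2 := FreeGroup.norm_mul_le (FreeGroup.mk [a]) w
    rw [SimpleGraph.Walk.length_cons]
    omega

theorem quotientCayley_dist_mul_le (x : FreeGroup α ⧸ N) (w : FreeGroup α) :
    (quotientCayley N).dist x (x * (w : FreeGroup α ⧸ N)) ≤ w.norm := by
  obtain ⟨p, hp⟩ : ∃ p : (quotientCayley N).Walk x (x * (w : FreeGroup α ⧸ N)),
      p.length ≤ w.toWord.length := by
    have := exists_walk_length_le N w.toWord x
    rwa [FreeGroup.mk_toWord] at this
  exact (SimpleGraph.dist_le p).trans hp

theorem quotientCayley_connected : (quotientCayley N).Connected := by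
  refine (SimpleGraph.connected_iff _).2 ⟨fun x y => ?_, ⟨1⟩⟩
  obtain ⟨w, hw⟩ := QuotientGroup.mk_surjective (x⁻¹ * y)
  obtain ⟨p, -⟩ := exists_walk_length_le N w.toWord x
  rw [FreeGroup.mk_toWord, hw, mul_inv_cancel_left] at p
  exact ⟨p⟩

theorem exists_norm_le_quotientCayley_dist (x y : FreeGroup α ⧸ N) :
    ∃ w : FreeGroup α, w.norm ≤ (quotientCayley N).dist x y ∧ x * (w : FreeGroup α ⧸ N) = y := by
  obtain ⟨p, hp⟩ := (quotientCayley_connected N).exists_walk_length_eq_dist x y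
  rw [← hp]
  exact exists_norm_le_of_walk N p

end Cayley

/-! ### The derived `m`-series of a free group -/

section DerivedSeries

variable {α : Type*}

theorem finite_quotient_derivedMSeries [Finite α] (m : ℕ) [NeZero m] (i : ℕ) :
    Finite (FreeGroup α ⧸ derivedMSeries (FreeGroup α) m i) := by
  classical
  induction i with
  | zero => exact inferInstanceAs (Finite (FreeGroup α ⧸ (⊤ : Subgroup (FreeGroup α))))
  | succ i ih => exact finite_quotient_mCommutator (derivedMSeries (FreeGroup α) m i) m

theorem succ_le_norm_of_mem_derivedMSeries [DecidableEq α] (m : ℕ) [Fact (1 < m)] (i : ℕ) :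
    ∀ w ∈ derivedMSeries (FreeGroup α) m i, w ≠ 1 → i + 1 ≤ w.norm := by
  induction i with
  | zero =>
    intro w _ hw
    rw [zero_add, Nat.one_le_iff_ne_zero, ne_eq, FreeGroup.norm_eq_zero]
    exact hw
  | succ i ih => exact fun w hw hw1 => succ_le_norm_of_mem_mCommutator m ih hw hw1

theorem derivedMSeries_antitone (G : Type*) [Group G] (m : ℕ) : Antitone (derivedMSeries G m) :=
  antitone_nat_of_succ_le fun i => mCommutator_le (derivedMSeries G m i) m

theorem iInf_derivedMSeries (m : ℕ) [Fact (1 < m)] :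
    ⨅ i, derivedMSeries (FreeGroup α) m i = ⊥ := by
  classical
  refine (Subgroup.eq_bot_iff_forall _).2 fun w hw => ?_
  by_contra hne
  have := succ_le_norm_of_mem_derivedMSeries m w.norm w (Subgroup.mem_iInf.1 hw _) hne
  omega

theorem isBoxSequence_derivedMSeries [Finite α] (m : ℕ) [NeZero m] [Fact (1 < m)] :
    IsBoxSequence (derivedMSeries (FreeGroup α) m) where
  antitone := derivedMSeries_antitone _ m
  normal := inferInstance
  finiteIndex i := by
    have := finite_quotient_derivedMSeries (α := α) m i
    exact Subgroup.finiteIndex_of_finite_quotient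
  iInf_eq_bot := iInf_derivedMSeries m

/-- The sizes of the quotients by the derived `m`-series tend to infinity. -/
theorem finite_setOf_card_quotient_le [Finite α] [Nonempty α] (m : ℕ) [NeZero m] [Fact (1 < m)]
    (C : ℕ) : {i | Nat.card (FreeGroup α ⧸ derivedMSeries (FreeGroup α) m i) ≤ C}.Finite := by
  classical
  obtain ⟨s⟩ := ‹Nonempty α›
  refine (Set.finite_lt_nat C).subset fun i hi => ?_
  by_contra hCi
  have := finite_quotient_derivedMSeries (α := α) m i
  -- The powers of a generator with exponents from `0` to `i` stay distinct, because their quotients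
  -- are shorter than every nontrivial relator.
  have hinj : Function.Injective fun k : Fin (i + 1) =>
      ((FreeGroup.of s ^ (k : ℕ) : FreeGroup α) :
        FreeGroup α ⧸ derivedMSeries (FreeGroup α) m i) := by
    have key : ∀ j k : Fin (i + 1), j < k →
        ((FreeGroup.of s ^ (j : ℕ) : FreeGroup α) :
          FreeGroup α ⧸ derivedMSeries (FreeGroup α) m i) ≠
        (FreeGroup.of s ^ (k : ℕ) : FreeGroup α) := fun j k hjk h => by
      have hmem := QuotientGroup.eq.1 h
      have hpow : (FreeGroup.of s ^ (j : ℕ))⁻¹ * FreeGroup.of s ^ (k : ℕ) =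
          FreeGroup.of s ^ ((k : ℕ) - j) := by
        rw [inv_mul_eq_iff_eq_mul, ← pow_add, Nat.add_sub_cancel' hjk.le]
      rw [hpow] at hmem
      have hnorm := FreeGroup.norm_of_pow s ((k : ℕ) - j)
      have hlt : (j : ℕ) < k := hjk
      have := succ_le_norm_of_mem_derivedMSeries m i _ hmem fun h1 => by
        rw [h1, FreeGroup.norm_one] at hnorm
        omega
      omega
    intro j k h
    by_contra hne
    rcases lt_or_gt_of_ne hne with h' | h'
    · exact key j k h' h
    · exact key k j h' h.symm
  have hle := Nat.card_le_card_of_injective _ hinj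
  have hi' : Nat.card (FreeGroup α ⧸ derivedMSeries (FreeGroup α) m i) ≤ C := hi
  have hCi' : ¬ i < C := hCi
  rw [Nat.card_eq_fintype_card, Fintype.card_fin] at hle
  omega

end DerivedSeries

/-! ### Criteria for coarse embeddability -/

section CoarseEmbedding

theorem coarselyEmbeds_of_forall_exists {X Y : Type*} [MetricSpace X] [MetricSpace Y] (F : X → Y)
    (hup : ∀ R : ℝ, ∃ K : ℝ, ∀ x y, dist x y ≤ R → dist (F x) (F y) ≤ K)
    (hlow : ∀ K : ℝ, ∃ R : ℝ, ∀ x y, dist (F x) (F y) ≤ K → dist x y ≤ R) :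
    CoarselyEmbeds X Y := by
  -- The control functions are the infimum and supremum of the image distances occurring beyond and
  -- within `t`. Adjoining `Set.Ici t` and `Set.Iic t` keeps the sets nonempty; the latter makes the
  -- supremum diverge even if `X` is bounded.
  let A : ℝ≥0 → Set ℝ≥0 := fun t =>
    {s | ∃ x y, t ≤ nndist x y ∧ nndist (F x) (F y) = s} ∪ Set.Ici t
  let B : ℝ≥0 → Set ℝ≥0 := fun t =>
    {s | ∃ x y, nndist x y ≤ t ∧ nndist (F x) (F y) = s} ∪ Set.Iic t
  have hA : ∀ t, t ∈ A t := fun t => Or.inr (show t ≤ t from le_rfl)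
  have hB : ∀ t, t ∈ B t := fun t => Or.inr (show t ≤ t from le_rfl)
  have hBb : ∀ t, BddAbove (B t) := fun t => by
    obtain ⟨K, hK⟩ := hup t
    refine ⟨max K.toNNReal t, ?_⟩
    rintro s (⟨x, y, hxy, rfl⟩ | hs)
    · exact le_max_of_le_left (NNReal.le_toNNReal_of_coe_le (hK x y hxy))
    · exact le_max_of_le_right hs
  refine ⟨F, fun t => sInf (A t), fun t => sSup (B t), fun t t' htt => ?_, fun t t' htt => ?_,
    Filter.tendsto_atTop.2 fun K => ?_, Filter.tendsto_atTop.2 fun K => ?_, fun x y => ⟨?_, ?_⟩⟩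
  · refine csInf_le_csInf (OrderBot.bddBelow _) ⟨t', hA t'⟩ ?_
    exact Set.union_subset_union (fun s ⟨x, y, h, hs⟩ => ⟨x, y, htt.trans h, hs⟩)
      (Set.Ici_subset_Ici.2 htt)
  · refine csSup_le_csSup (hBb t') ⟨t, hB t⟩ ?_
    exact Set.union_subset_union (fun s ⟨x, y, h, hs⟩ => ⟨x, y, h.trans htt, hs⟩)
      (Set.Iic_subset_Iic.2 htt)
  · obtain ⟨R, hR⟩ := hlow K
    filter_upwards [Filter.eventually_gt_atTop R.toNNReal, Filter.eventually_ge_atTop K]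
      with t ht htK
    refine le_csInf ⟨t, hA t⟩ ?_
    rintro s (⟨x, y, hxy, rfl⟩ | hs)
    · by_contra! hlt
      have h1 := hR x y (le_of_lt hlt)
      have h2 : nndist x y ≤ R.toNNReal := NNReal.le_toNNReal_of_coe_le h1
      exact absurd (ht.trans_le hxy) (not_lt.2 h2)
    · exact htK.trans hs
  · filter_upwards [Filter.eventually_ge_atTop K] with t ht
    exact ht.trans (le_csSup (hBb t) (hB t))
  · exact csInf_le (OrderBot.bddBelow _) (Or.inl ⟨x, y, le_rfl, rfl⟩)
  · exact le_csSup (hBb _) (Or.inl ⟨x, y, le_rfl, rfl⟩)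

theorem norm_sum_smul_sq_of_orthonormal {E I : Type*} [NormedAddCommGroup E]
    [InnerProductSpace ℝ E] {b : I → E} (hb : Orthonormal ℝ b) [Fintype I] (c : I → ℝ) :
    ‖∑ i, c i • b i‖ ^ 2 = ∑ i, c i ^ 2 := by
  rw [← real_inner_self_eq_norm_sq, hb.inner_sum]
  simp [sq]

theorem exists_orthonormal_lp (I : Type*) [Countable I] :
    ∃ b : I → lp (fun _ : ℕ => ℝ) 2, Orthonormal ℝ b := by
  obtain ⟨e, he⟩ := exists_injective_nat I
  let h : HilbertBasis ℕ ℝ (lp (fun _ : ℕ => ℝ) 2) :=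
    HilbertBasis.ofRepr (LinearIsometryEquiv.refl ℝ _)
  exact ⟨h ∘ e, h.orthonormal.comp e he⟩

/-- Only finitely many components meet a bounded neighbourhood of another component. -/
theorem ComponentsDiverge.finite_left {ι : Type*} {X : ι → Type*} [MetricSpace (Σ i, X i)]
    (h : ComponentsDiverge X) (R : ℝ) :
    {i | ∃ j, i ≠ j ∧ ∃ (x : X i) (y : X j),
      dist (⟨i, x⟩ : Σ i, X i) ⟨j, y⟩ ≤ R}.Finite := by
  refine ((h R).image Prod.fst).subset ?_
  rintro i ⟨j, hij, x, y, hxy⟩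
  exact ⟨(i, j), ⟨hij, x, y, hxy⟩, rfl⟩

/-- The components get mutually orthogonal coordinates, and the `i`-th one is shifted by `i` along a
further basis vector. Both within a bounded distance in `X` and within a bounded distance of images,
pairs from distinct components involve only finitely many points. -/
theorem coarselyEmbedsInHilbert_of_components {X : ℕ → Type*} [∀ i, Finite (X i)]
    [MetricSpace (Σ i, X i)] (hdiv : ComponentsDiverge X) {J : ℕ → Type*} [∀ i, Fintype (J i)]
    (f : ∀ i, X i → J i → ℝ)
    (hup : ∀ R : ℝ, ∃ K : ℝ, ∀ i (x y : X i), dist (⟨i, x⟩ : Σ i, X i) ⟨i, y⟩ ≤ R →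
      ∑ j, (f i x j - f i y j) ^ 2 ≤ K)
    (hlow : ∀ K : ℝ, ∃ R : ℝ, ∀ i (x y : X i), ∑ j, (f i x j - f i y j) ^ 2 ≤ K →
      dist (⟨i, x⟩ : Σ i, X i) ⟨i, y⟩ ≤ R) :
    CoarselyEmbedsInHilbert (Σ i, X i) := by
  obtain ⟨b, hb⟩ := exists_orthonormal_lp (ℕ ⊕ Σ i, J i)
  let F : (Σ i, X i) → lp (fun _ : ℕ => ℝ) 2 := fun p =>
    (p.1 : ℝ) • b (Sum.inl p.1) + ∑ j, f p.1 p.2 j • b (Sum.inr ⟨p.1, j⟩)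
  have hsame : ∀ i (x y : X i), dist (F ⟨i, x⟩) (F ⟨i, y⟩) ^ 2 =
      ∑ j, (f i x j - f i y j) ^ 2 := fun i x y => by
    have hbi : Orthonormal ℝ fun j : J i => b (Sum.inr ⟨i, j⟩) :=
      hb.comp (fun j => Sum.inr ⟨i, j⟩) fun j k h => by simpa using h
    rw [dist_eq_norm, ← norm_sum_smul_sq_of_orthonormal hbi]
    simp only [F, add_sub_add_left_eq_sub, sub_smul, Finset.sum_sub_distrib]
  have hleft : ∀ p q : Σ i, X i, p.1 ≠ q.1 → (p.1 : ℝ) ≤ dist (F p) (F q) := fun p q hpq => by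
    have h1 : inner ℝ (b (Sum.inl p.1)) (F p - F q) = (p.1 : ℝ) := by
      classical
      simp [F, inner_sub_right, inner_add_right, inner_sum, inner_smul_right,
        orthonormal_iff_ite.1 hb, hpq, hb.1]
    calc (p.1 : ℝ) = inner ℝ (b (Sum.inl p.1)) (F p - F q) := h1.symm
      _ ≤ ‖b (Sum.inl p.1)‖ * ‖F p - F q‖ := real_inner_le_norm _ _
      _ = dist (F p) (F q) := by rw [hb.1, one_mul, dist_eq_norm]
  have hfin : ∀ s : Set ℕ, s.Finite → {p : Σ i, X i | p.1 ∈ s}.Finite := fun s hs => by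
    have : {p : Σ i, X i | p.1 ∈ s} ⊆ ⋃ i ∈ s, Set.range (Sigma.mk i) := fun p hp =>
      Set.mem_iUnion₂.2 ⟨p.1, hp, p.2, rfl⟩
    exact (hs.biUnion fun i _ => Set.finite_range _).subset this
  refine coarselyEmbeds_of_forall_exists F (fun R => ?_) fun K => ?_
  · obtain ⟨K₁, hK₁⟩ := hup R
    obtain ⟨K₂, hK₂⟩ := Metric.isBounded_iff.1
      ((hfin _ (hdiv.finite_left R)).image F).isBounded
    refine ⟨max (Real.sqrt K₁) K₂, fun p q hpq => ?_⟩
    by_cases h : p.1 = q.1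
    · obtain ⟨i, x⟩ := p
      obtain ⟨k, y⟩ := q
      obtain rfl : i = k := h
      refine le_max_of_le_left (Real.le_sqrt_of_sq_le ?_)
      rw [hsame]
      exact hK₁ i x y hpq
    · exact le_max_of_le_right (hK₂ ⟨p, ⟨q.1, h, p.2, q.2, hpq⟩, rfl⟩
        ⟨q, ⟨p.1, Ne.symm h, q.2, p.2, by rwa [dist_comm]⟩, rfl⟩)
  · obtain ⟨R₁, hR₁⟩ := hlow (K ^ 2)
    obtain ⟨R₂, hR₂⟩ := Metric.isBounded_iff.1 (hfin _ (Set.finite_le_nat ⌊K⌋₊)).isBounded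
    refine ⟨max R₁ R₂, fun p q hpq => ?_⟩
    by_cases h : p.1 = q.1
    · obtain ⟨i, x⟩ := p
      obtain ⟨k, y⟩ := q
      obtain rfl : i = k := h
      refine le_max_of_le_left (hR₁ i x y ?_)
      rw [← hsame]
      exact pow_le_pow_left₀ dist_nonneg hpq 2
    · refine le_max_of_le_right (hR₂ (Nat.le_floor ((hleft p q h).trans hpq))
        (Nat.le_floor ((hleft q p (Ne.symm h)).trans ?_)))
      rwa [dist_comm]

theorem hasBoundedGeometry_of_components {X : ℕ → Type*} [∀ i, Finite (X i)]
    [MetricSpace (Σ i, X i)] (hdiv : ComponentsDiverge X)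
    (hB : ∀ r : ℝ, ∃ B : ℕ, ∀ i (x : X i),
      {y : X i | dist (⟨i, x⟩ : Σ i, X i) ⟨i, y⟩ ≤ r}.encard ≤ B) :
    HasBoundedGeometry (Σ i, X i) := by
  intro r
  obtain ⟨B, hB⟩ := hB r
  set T : Set (Σ i, X i) := ⋃ i ∈ {i | ∃ j, i ≠ j ∧ ∃ (x : X i) (y : X j),
      dist (⟨i, x⟩ : Σ i, X i) ⟨j, y⟩ ≤ r}, Set.range (Sigma.mk i)
  have hT : T.Finite := (hdiv.finite_left r).biUnion fun i _ => Set.finite_range _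
  refine ⟨B + T.ncard, fun ⟨i, x⟩ => ?_⟩
  have hsub : Metric.closedBall (⟨i, x⟩ : Σ i, X i) r ⊆
      Sigma.mk i '' {y : X i | dist (⟨i, x⟩ : Σ i, X i) ⟨i, y⟩ ≤ r} ∪ T := by
    rintro ⟨k, y⟩ hy
    rw [Metric.mem_closedBall] at hy
    by_cases h : k = i
    · subst h
      exact Or.inl ⟨y, by rwa [Set.mem_ofPred_eq, dist_comm], rfl⟩
    · exact Or.inr (Set.mem_iUnion₂.2 ⟨k, ⟨i, h, y, x, hy⟩, y, rfl⟩)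
  calc (Metric.closedBall (⟨i, x⟩ : Σ i, X i) r).encard
      ≤ _ := Set.encard_le_encard hsub
    _ ≤ _ := Set.encard_union_le _ _
    _ ≤ (B : ℕ∞) + T.ncard :=
      add_le_add ((Set.encard_image_le _ _).trans (hB i x)) hT.cast_ncard_eq.ge
    _ = ((B + T.ncard : ℕ) : ℕ∞) := by push_cast; rfl

/-- Bounded metric spaces, indexed by the natural numbers, have a coarse disjoint union. -/
theorem exists_isCoarseDisjointUnion {X : ℕ → Type*} (d : ∀ i, X i → X i → ℝ)
    (hself : ∀ i x, d i x x = 0) (hcomm : ∀ i x y, d i x y = d i y x)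
    (htri : ∀ i x y z, d i x z ≤ d i x y + d i y z) (heq : ∀ i x y, d i x y = 0 → x = y)
    (hbdd : ∀ i, ∃ D, ∀ x y, d i x y ≤ D) :
    ∃ _ : MetricSpace (Σ i, X i), IsCoarseDisjointUnion d ∧ ComponentsDiverge X := by
  choose D hD using hbdd
  let h : ℕ → ℝ := fun i => |D i| + i + 1
  have hpos : ∀ i, 0 < h i := fun i => by positivity
  have hDh : ∀ i x y, d i x y < h i := fun i x y => by
    have := (hD i x y).trans (le_abs_self _)
    have : (0 : ℝ) ≤ i := Nat.cast_nonneg i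
    simp only [h]
    linarith
  let δ : (Σ i, X i) → (Σ i, X i) → ℝ := fun p q =>
    if e : p.1 = q.1 then d q.1 (e ▸ p.2) q.2 else h p.1 + h q.1
  have hδsame : ∀ i x y, δ ⟨i, x⟩ ⟨i, y⟩ = d i x y := fun i x y => by simp [δ]
  have hδne : ∀ i j x y, i ≠ j → δ ⟨i, x⟩ ⟨j, y⟩ = h i + h j := fun i j x y hij => by
    simp [δ, hij]
  have hnonneg : ∀ i x y, 0 ≤ d i x y := fun i x y => by
    have := htri i x y x
    rw [hself, hcomm i y x] at this
    linarith
  let M : MetricSpace (Σ i, X i) :=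
    { dist := δ
      dist_self := fun ⟨i, x⟩ => by rw [hδsame, hself]
      dist_comm := fun ⟨i, x⟩ ⟨j, y⟩ => by
        by_cases hij : i = j
        · subst hij
          rw [hδsame, hδsame, hcomm]
        · rw [hδne _ _ _ _ hij, hδne _ _ _ _ (Ne.symm hij), add_comm]
      dist_triangle := fun ⟨i, x⟩ ⟨j, y⟩ ⟨k, z⟩ => by
        by_cases hij : i = j
        · subst hij
          by_cases hik : i = k
          · subst hik
            rw [hδsame, hδsame, hδsame]
            exact htri i x y z
          · rw [hδsame, hδne _ _ _ _ hik, hδne _ _ _ _ hik]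
            linarith [hnonneg i x y]
        · by_cases hjk : j = k
          · subst hjk
            rw [hδsame, hδne _ _ _ _ hij, hδne _ _ _ _ hij]
            linarith [hnonneg j y z]
          · by_cases hik : i = k
            · subst hik
              rw [hδsame, hδne _ _ _ _ hij, hδne _ _ _ _ hjk]
              linarith [hDh i x z, hpos i, hpos j]
            · rw [hδne _ _ _ _ hik, hδne _ _ _ _ hij, hδne _ _ _ _ hjk]
              linarith [hpos j]
      eq_of_dist_eq_zero := fun {p q} hpq => by
        obtain ⟨i, x⟩ := p
        obtain ⟨j, y⟩ := q
        change δ _ _ = 0 at hpq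
        by_cases hij : i = j
        · subst hij
          rw [hδsame] at hpq
          rw [heq i x y hpq]
        · rw [hδne _ _ _ _ hij] at hpq
          linarith [hpos i, hpos j] }
  refine ⟨M, ⟨hδsame, fun i j hij x y u v => ?_⟩, fun R => ?_⟩
  · change _ < δ _ _
    rw [hδne _ _ _ _ hij]
    linarith [hDh i u v, hpos j]
  · refine ((Set.finite_le_nat ⌊R⌋₊).prod (Set.finite_le_nat ⌊R⌋₊)).subset ?_
    rintro ⟨i, j⟩ ⟨hij, x, y, hxy⟩
    change δ _ _ ≤ R at hxy
    rw [hδne _ _ _ _ hij] at hxy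
    have hi : (i : ℝ) ≤ h i := by
      simp only [h]
      linarith [abs_nonneg (D i)]
    have hj : (j : ℝ) ≤ h j := by
      simp only [h]
      linarith [abs_nonneg (D j)]
    exact ⟨Nat.le_floor (by linarith [hpos j]), Nat.le_floor (by linarith [hpos i])⟩

end CoarseEmbedding

/-! ### Feature maps on the quotients of the derived `m`-series -/

section Features

open scoped Classical

variable {α : Type*} [DecidableEq α] (N : Subgroup (FreeGroup α)) [N.Normal] (m : ℕ)

theorem card_fox_ne_eq [Fintype α] [Fintype (FreeGroup α ⧸ N)] (a b : FreeGroup α) :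
    (Finset.univ.filter fun e => fox N m a e ≠ fox N m b e).card =
      (Finset.univ.filter fun e => fox N m (a⁻¹ * b) e ≠ 0).card := by
  refine Finset.card_bij (fun e _ => ((a : FreeGroup α ⧸ N)⁻¹ * e.1, e.2)) (fun e he => ?_)
    (fun e _ e' _ h => ?_) fun e he => ⟨((a : FreeGroup α ⧸ N) * e.1, e.2), ?_, by simp⟩
  · have := fox_mul N m a (a⁻¹ * b) e
    rw [mul_inv_cancel_left] at this
    simpa [this] using he
  · simpa [Prod.ext_iff] using h
  · have := fox_mul N m a (a⁻¹ * b) ((a : FreeGroup α ⧸ N) * e.1, e.2)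
    rw [mul_inv_cancel_left] at this
    simpa [this] using he

/-- One-hot encoding turns Hamming distance into squared Euclidean distance: each disagreement
changes exactly two coordinates. -/
theorem sum_sq_sub_indicator {E C : Type*} [Fintype E] [Fintype C] [DecidableEq C] (u v : E → C) :
    ∑ p : E × C, ((if u p.1 = p.2 then (1 : ℝ) else 0) - if v p.1 = p.2 then 1 else 0) ^ 2 =
      2 * ((Finset.univ.filter fun e => u e ≠ v e).card : ℝ) := by
  rw [Fintype.sum_prod_type, Finset.card_filter, Nat.cast_sum, Finset.mul_sum]
  refine Finset.sum_congr rfl fun e _ => ?_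
  have h : ∀ c : C, ((if u e = c then (1 : ℝ) else 0) - if v e = c then 1 else 0) ^ 2 =
      (if u e = c then 1 else 0) + (if v e = c then 1 else 0) -
        2 * if u e = c then (if v e = c then 1 else 0) else 0 := fun c => by
    split_ifs <;> norm_num
  simp only [h, Finset.sum_sub_distrib, Finset.sum_add_distrib, ← Finset.mul_sum,
    Finset.sum_ite_eq, Finset.mem_univ, if_true]
  by_cases huv : u e = v e
  · norm_num [huv]
  · norm_num [huv, Ne.symm huv]

variable {N m} {g : ℕ}

theorem card_fox_ne_le_dist [Fintype α] [Fintype (FreeGroup α ⧸ N)] [(mCommutator N m).Normal]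
    (x y : FreeGroup α ⧸ mCommutator N m) :
    (Finset.univ.filter fun e => fox N m x.out e ≠ fox N m y.out e).card ≤
      (quotientCayley (mCommutator N m)).dist x y := by
  obtain ⟨w, hw, hxy⟩ := exists_norm_le_quotientCayley_dist _ x y
  rw [card_fox_ne_eq]
  have hmem : w⁻¹ * (x.out⁻¹ * y.out) ∈ mCommutator N m := by
    rw [← QuotientGroup.eq, QuotientGroup.mk_mul, QuotientGroup.mk_inv, QuotientGroup.out_eq',
      QuotientGroup.out_eq', ← hxy, inv_mul_cancel_left]
  rw [← ((inv_mul_mem_mCommutator_iff N m _ _).1 hmem).2]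
  exact (card_fox_support_le m w).trans hw

theorem dist_le_card_fox_ne [Fintype α] [Fintype (FreeGroup α ⧸ N)] [(mCommutator N m).Normal]
    [Fact (1 < m)] (hg : ∀ w ∈ N, w ≠ 1 → g ≤ w.norm) (x y : FreeGroup α ⧸ mCommutator N m)
    (h : (Finset.univ.filter fun e => fox N m x.out e ≠ fox N m y.out e).card < g) :
    (quotientCayley (mCommutator N m)).dist x y ≤
      (Finset.univ.filter fun e => fox N m x.out e ≠ fox N m y.out e).card := by
  rw [card_fox_ne_eq] at h ⊢
  obtain ⟨w, hw, hmem⟩ := exists_norm_le_card_fox_support m hg _ h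
  rw [← QuotientGroup.eq, QuotientGroup.mk_mul, QuotientGroup.mk_inv, QuotientGroup.out_eq',
    QuotientGroup.out_eq', inv_mul_eq_iff_eq_mul] at hmem
  refine le_trans ?_ hw
  rw [hmem]
  exact quotientCayley_dist_mul_le _ x w

end Features

theorem exists_feature_map {α : Type} [Finite α] (m : ℕ) [NeZero m] [Fact (1 < m)] (i : ℕ) :
    ∃ (J : Type) (_ : Fintype J) (f : FreeGroup α ⧸ derivedMSeries (FreeGroup α) m i → J → ℝ),
      ∀ x y, ∑ j, (f x j - f y j) ^ 2 ≤
          2 * (quotientCayley (derivedMSeries (FreeGroup α) m i)).dist x y ∧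
        (∑ j, (f x j - f y j) ^ 2 < 2 * i →
          2 * ((quotientCayley (derivedMSeries (FreeGroup α) m i)).dist x y : ℝ) ≤
            ∑ j, (f x j - f y j) ^ 2) := by
  classical
  cases i with
  | zero =>
    refine ⟨PEmpty, inferInstance, fun _ _ => 0, fun x y => ?_⟩
    simp
  | succ i =>
    have := Fintype.ofFinite α
    have := finite_quotient_derivedMSeries (α := α) m i
    have := Fintype.ofFinite (FreeGroup α ⧸ derivedMSeries (FreeGroup α) m i)
    have : (mCommutator (derivedMSeries (FreeGroup α) m i) m).Normal :=
      derivedMSeries_normal _ m (i + 1)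
    refine ⟨_, inferInstance,
      fun (x : FreeGroup α ⧸ mCommutator (derivedMSeries (FreeGroup α) m i) m)
        (p : ((FreeGroup α ⧸ derivedMSeries (FreeGroup α) m i) × α) × ZMod m) =>
        if fox (derivedMSeries (FreeGroup α) m i) m x.out p.1 = p.2 then 1 else 0, fun x y => ?_⟩
    have hsum := sum_sq_sub_indicator (fox (derivedMSeries (FreeGroup α) m i) m
      (Quotient.out (x : FreeGroup α ⧸ mCommutator (derivedMSeries (FreeGroup α) m i) m)))
      (fox (derivedMSeries (FreeGroup α) m i) m
      (Quotient.out (y : FreeGroup α ⧸ mCommutator (derivedMSeries (FreeGroup α) m i) m)))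
    have h1 := card_fox_ne_le_dist (N := derivedMSeries (FreeGroup α) m i) (m := m) x y
    have h2 := dist_le_card_fox_ne (N := derivedMSeries (FreeGroup α) m i) (m := m)
      (succ_le_norm_of_mem_derivedMSeries m i) x y
    refine ⟨(le_of_eq hsum).trans ?_, fun h => ?_⟩
    · exact mul_le_mul_of_nonneg_left (Nat.cast_le.2 h1) zero_le_two
    · refine le_trans (mul_le_mul_of_nonneg_left (Nat.cast_le.2 (h2 ?_)) zero_le_two) hsum.ge
      have h3 := (le_of_eq hsum.symm).trans_lt h
      rw [mul_lt_mul_iff_right₀ zero_lt_two] at h3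
      exact_mod_cast h3

/-! ### Free groups are not amenable -/

section NonAmenable

variable {α : Type*} [DecidableEq α]

theorem univ_subset_startsWith_union (s : α) :
    (Set.univ : Set (FreeGroup α)) ⊆ FreeGroup.startsWith (s, true) ∪
      {w | (FreeGroup.of s)⁻¹ * w ∈ FreeGroup.startsWith (s, false)} := by
  intro w _
  by_cases hw : w ∈ FreeGroup.startsWith (s, true)
  · exact Or.inl hw
  · exact Or.inr (FreeGroup.startsWith_mk_mul (w := (s, false)) w hw)

/-- There is no almost invariant finitely additive measure on a free group of rank at least two,
in the form of a weighted family of elements. -/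
theorem false_of_almost_invariant {a b : α} (hab : a ≠ b) {P : Type*} [Fintype P] (c : P → ℝ)
    (hc : ∀ p, 0 ≤ c p) (lam : P → FreeGroup α) (hpos : 0 < ∑ p, c p)
    (hinv : ∀ (s : α) (A : Set (FreeGroup α)),
      ∑ p, c p * A.indicator 1 ((FreeGroup.of s)⁻¹ * lam p) ≤
        ∑ p, c p * A.indicator 1 (lam p) + 1 / 4 * ∑ p, c p) : False := by
  let μ : Set (FreeGroup α) → ℝ := fun A => ∑ p, c p * A.indicator 1 (lam p)
  let W : α → Bool → Set (FreeGroup α) := fun s β => FreeGroup.startsWith (s, β)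
  -- Words starting with `s` and the `s`-translate of words starting with `s⁻¹` cover the group, so
  -- the two starting sets have mass at least `3 / 4`. Two generators would give `3 / 2` on disjoint
  -- sets.
  have key : ∀ s, ∑ p, c p ≤ μ (W s true) + μ (W s false) + 1 / 4 * ∑ p, c p := fun s => by
    have h1 := hinv s (W s false)
    have h2 : ∑ p, c p ≤ μ (W s true) +
        ∑ p, c p * (W s false).indicator 1 ((FreeGroup.of s)⁻¹ * lam p) := by
      rw [← Finset.sum_add_distrib]
      refine Finset.sum_le_sum fun p _ => ?_
      rw [← mul_add]
      refine le_mul_of_one_le_right (hc p) ?_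
      have hnn : ∀ (A : Set (FreeGroup α)) w, (0 : ℝ) ≤ A.indicator 1 w := fun A w =>
        Set.indicator_nonneg (fun _ _ => zero_le_one) w
      rcases univ_subset_startsWith_union s (Set.mem_univ (lam p)) with h | h
      · rw [Set.indicator_of_mem (s := W s true) h, Pi.one_apply]
        linarith [hnn (W s false) ((FreeGroup.of s)⁻¹ * lam p)]
      · rw [Set.indicator_of_mem (s := W s false) h, Pi.one_apply]
        linarith [hnn (W s true) (lam p)]
    linarith
  have hsum : μ (W a true) + μ (W a false) + μ (W b true) + μ (W b false) ≤ ∑ p, c p := by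
    simp only [μ, ← Finset.sum_add_distrib, ← mul_add]
    refine Finset.sum_le_sum fun p _ => mul_le_of_le_one_right (hc p) ?_
    simp only [W, FreeGroup.startsWith, Set.indicator_apply, Set.mem_ofPred_eq, Pi.one_apply]
    by_cases h : ∃ l, (lam p).toWord[0]? = some l
    · obtain ⟨⟨s, β⟩, h⟩ := h
      rw [h]
      by_cases hsa : s = a
      · subst hsa
        cases β <;> simp [hab]
      · by_cases hsb : s = b
        · subst hsb
          cases β <;> simp [hsa]
        · simp [hsa, hsb]
    · push Not at h
      simp [h]
  have ha := key a
  have hb := key b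
  linarith

theorem sum_abs_sq_sub_sq_le {ι : Type*} [Fintype ι] (u v : ι → ℝ) (hu : ∑ i, u i ^ 2 = 1)
    (hv : ∑ i, v i ^ 2 = 1) (huv : 1 - 1 / 256 ≤ ∑ i, u i * v i) :
    ∑ i, |u i ^ 2 - v i ^ 2| ≤ 1 / 4 := by
  -- The right side is `8 (u - v)² + (u² + v²) / 16`, a weighted arithmetic-geometric bound for `|u
  -- - v| |u + v|`; it sums to at most `3 / 16`.
  have h : ∀ i, |u i ^ 2 - v i ^ 2| ≤
      (8 + 1 / 16) * u i ^ 2 + (8 + 1 / 16) * v i ^ 2 - 16 * (u i * v i) := fun i => by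
    rw [abs_le]
    constructor <;> nlinarith [sq_nonneg ((u i + v i) / 16 + (u i - v i)),
      sq_nonneg ((u i + v i) / 16 - (u i - v i)), sq_nonneg (u i - v i)]
  refine (Finset.sum_le_sum fun i _ => h i).trans ?_
  rw [Finset.sum_sub_distrib, Finset.sum_add_distrib, ← Finset.mul_sum, ← Finset.mul_sum,
    ← Finset.mul_sum, hu, hv]
  linarith

variable (N : Subgroup (FreeGroup α))

theorem exists_minimal_lift (u : FreeGroup α ⧸ N) :
    ∃ w : FreeGroup α, (w : FreeGroup α ⧸ N) = u ∧
      ∀ w' : FreeGroup α, (w' : FreeGroup α ⧸ N) = u → w.norm ≤ w'.norm := by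
  classical
  have h : ∃ k, ∃ w : FreeGroup α, (w : FreeGroup α ⧸ N) = u ∧ w.norm = k := by
    obtain ⟨w, hw⟩ := QuotientGroup.mk_surjective u
    exact ⟨_, w, hw, rfl⟩
  obtain ⟨w, hw, hk⟩ := Nat.find_spec h
  exact ⟨w, hw, fun w' hw' => hk ▸ Nat.find_min' h ⟨w', hw', rfl⟩⟩

/-- A quotient of a free group of rank at least two without short relations does not carry almost
equivariant unit vectors with small supports. -/
theorem false_of_almost_equivariant [N.Normal] {a b : α} (hab : a ≠ b)
    [Fintype (FreeGroup α ⧸ N)] (S : ℕ)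
    (hg : ∀ w ∈ N, w ≠ 1 → 2 * S + 3 ≤ w.norm)
    (f : FreeGroup α ⧸ N → FreeGroup α ⧸ N → ℝ) (hf : ∀ x, ∑ z, f x z ^ 2 = 1)
    (hsupp : ∀ x z, f x z ≠ 0 → ∃ w : FreeGroup α, w.norm ≤ S ∧ x * (w : FreeGroup α ⧸ N) = z)
    (hinv : ∀ x (s : α), 1 - 1 / 256 ≤
      ∑ z, f x z * f (x * (FreeGroup.of s : FreeGroup α)) z) : False := by
  choose lift hlift hmin using exists_minimal_lift N
  refine false_of_almost_invariant hab
    (P := (FreeGroup α ⧸ N) × (FreeGroup α ⧸ N)) (fun p => f p.1 p.2 ^ 2)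
    (fun p => sq_nonneg _) (fun p => lift (p.1⁻¹ * p.2)) ?_ fun s A => ?_
  · simp [Fintype.sum_prod_type, hf, Fintype.card_pos]
  simp only [Fintype.sum_prod_type]
  -- On the support, minimal lifts commute with translation by `s⁻¹`: both candidates have length at
  -- most `S + 1` and the same class, so they would otherwise differ by a relator of length at most
  -- `2 * S + 2`.
  have hshift : ∀ x z, f x z ^ 2 *
      A.indicator 1 ((FreeGroup.of s)⁻¹ * lift (x⁻¹ * z)) = f x z ^ 2 * A.indicator 1
        (lift ((x * (FreeGroup.of s : FreeGroup α))⁻¹ * z)) := fun x z => by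
    by_cases h0 : f x z = 0
    · simp [h0]
    obtain ⟨w, hw, rfl⟩ := hsupp x z h0
    congr 2
    set v := lift (x⁻¹ * (x * (w : FreeGroup α ⧸ N))) with hv
    set v' := lift ((x * (FreeGroup.of s : FreeGroup α))⁻¹ * (x * (w : FreeGroup α ⧸ N)))
    have hvw : (v : FreeGroup α ⧸ N) = w := by rw [hv, hlift, inv_mul_cancel_left]
    have hvS : v.norm ≤ S := (hmin _ w (by simp)).trans hw
    have h1 : ((FreeGroup.of s)⁻¹ * v).norm ≤ S + 1 := by
      refine (FreeGroup.norm_mul_le _ _).trans ?_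
      rw [FreeGroup.norm_inv_eq, FreeGroup.norm_of]
      omega
    have h2 : (((FreeGroup.of s)⁻¹ * v : FreeGroup α) : FreeGroup α ⧸ N) =
        (x * (FreeGroup.of s : FreeGroup α))⁻¹ * (x * (w : FreeGroup α ⧸ N)) := by
      simp [hvw, mul_assoc]
    have h3 : v'.norm ≤ S + 1 := (hmin _ _ h2).trans h1
    have hmem : ((FreeGroup.of s)⁻¹ * v)⁻¹ * v' ∈ N := by
      rw [← QuotientGroup.eq, h2, hlift]
    by_contra hne
    have h4 := hg _ hmem fun h => hne (inv_mul_eq_one.1 h)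
    have h5 := FreeGroup.norm_mul_le ((FreeGroup.of s)⁻¹ * v)⁻¹ v'
    rw [FreeGroup.norm_inv_eq] at h5
    omega
  -- Summing over all base points `x` makes up for the lack of equivariance of `f`.
  have hreindex : ∑ x, ∑ z, f x z ^ 2 * A.indicator 1 (lift (x⁻¹ * z)) =
      ∑ x, ∑ z, f (x * (FreeGroup.of s : FreeGroup α)) z ^ 2 *
        A.indicator 1 (lift ((x * (FreeGroup.of s : FreeGroup α))⁻¹ * z)) :=
    (Equiv.sum_comp (Equiv.mulRight ((FreeGroup.of s : FreeGroup α) : FreeGroup α ⧸ N))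
      (fun x => ∑ z, f x z ^ 2 * A.indicator 1 (lift (x⁻¹ * z)))).symm
  rw [hreindex, Finset.mul_sum, ← Finset.sum_add_distrib]
  refine Finset.sum_le_sum fun x _ => ?_
  rw [hf x, mul_one, ← sub_le_iff_le_add', ← Finset.sum_sub_distrib]
  refine (Finset.sum_le_sum fun z _ => ?_).trans
    (sum_abs_sq_sub_sq_le (f x) _ (hf x) (hf _) (hinv x s))
  rw [hshift, ← sub_mul]
  refine (le_abs_self _).trans ?_
  rw [abs_mul]
  refine mul_le_of_le_one_right (abs_nonneg _) ?_
  classical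
  rw [Set.indicator_apply]
  split_ifs <;> simp

end NonAmenable

/-! ### The box space of the derived `m`-series -/

section BoxSpace

theorem finite_setOf_norm_le {α : Type*} [Finite α] [DecidableEq α] (k : ℕ) :
    {w : FreeGroup α | w.norm ≤ k}.Finite := by
  refine Set.Finite.of_finite_image ((List.finite_length_le (α × Bool) k).subset ?_)
    FreeGroup.toWord_injective.injOn
  rintro _ ⟨w, hw, rfl⟩
  exact hw

variable {n m : ℕ}

theorem IsDerivedBoxMetric.dist_eq [MetricSpace (DerivedBoxSpace n m)]
    (h : IsDerivedBoxMetric n m) (i : ℕ)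
    (x y : FreeGroup (Fin n) ⧸ derivedMSeries (FreeGroup (Fin n)) m i) :
    dist (⟨i, x⟩ : DerivedBoxSpace n m) ⟨i, y⟩ =
      (quotientCayley (derivedMSeries (FreeGroup (Fin n)) m i)).dist x y :=
  h.dist_same i x y

theorem exists_norm_le_of_quotientCayley_dist_le {α : Type*} [DecidableEq α]
    (N : Subgroup (FreeGroup α)) [N.Normal] {x y : FreeGroup α ⧸ N} {r : ℝ}
    (h : ((quotientCayley N).dist x y : ℝ) ≤ r) :
    ∃ w : FreeGroup α, w.norm ≤ ⌊r⌋₊ ∧ x * (w : FreeGroup α ⧸ N) = y := by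
  obtain ⟨w, hw, hxy⟩ := exists_norm_le_quotientCayley_dist N x y
  exact ⟨w, hw.trans (Nat.le_floor h), hxy⟩

theorem encard_quotientCayley_ball_le {α : Type*} [Finite α] [DecidableEq α]
    (N : Subgroup (FreeGroup α)) [N.Normal] (x : FreeGroup α ⧸ N) (r : ℝ) :
    {y | ((quotientCayley N).dist x y : ℝ) ≤ r}.encard ≤
      ({w : FreeGroup α | w.norm ≤ ⌊r⌋₊}.ncard : ℕ∞) := by
  have hsub : {y | ((quotientCayley N).dist x y : ℝ) ≤ r} ⊆
      (fun w : FreeGroup α => x * (w : FreeGroup α ⧸ N)) '' {w | w.norm ≤ ⌊r⌋₊} := by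
    intro y hy
    obtain ⟨w, hw, hxy⟩ := exists_norm_le_of_quotientCayley_dist_le N hy
    exact ⟨w, hw, hxy⟩
  rw [(finite_setOf_norm_le _).cast_ncard_eq]
  exact (Set.encard_le_encard hsub).trans (Set.encard_image_le _ _)

/-- A component within `R` of another has diameter below `R`, so it is covered by a ball whose size
is bounded independently of the component; but the quotients grow. -/
theorem IsDerivedBoxMetric.componentsDiverge [NeZero m] [Fact (1 < m)] (hn : n ≠ 0)
    [MetricSpace (DerivedBoxSpace n m)] (h : IsDerivedBoxMetric n m) :
    ComponentsDiverge
      (fun i : ℕ => FreeGroup (Fin n) ⧸ derivedMSeries (FreeGroup (Fin n)) m i) := by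
  intro R
  have : Nonempty (Fin n) := ⟨⟨0, Nat.pos_of_ne_zero hn⟩⟩
  have hfin := finite_setOf_card_quotient_le (α := Fin n) m
    {w : FreeGroup (Fin n) | w.norm ≤ ⌊R⌋₊}.ncard
  have key : ∀ i j : ℕ, i ≠ j →
      (∃ (x : FreeGroup (Fin n) ⧸ derivedMSeries (FreeGroup (Fin n)) m i)
        (y : FreeGroup (Fin n) ⧸ derivedMSeries (FreeGroup (Fin n)) m j),
        dist (⟨i, x⟩ : DerivedBoxSpace n m) ⟨j, y⟩ ≤ R) →
      Nat.card (FreeGroup (Fin n) ⧸ derivedMSeries (FreeGroup (Fin n)) m i) ≤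
        {w : FreeGroup (Fin n) | w.norm ≤ ⌊R⌋₊}.ncard := by
    rintro i j hij ⟨x, y, hxy⟩
    have := finite_quotient_derivedMSeries (α := Fin n) m i
    have huniv : {z | ((quotientCayley (derivedMSeries (FreeGroup (Fin n)) m i)).dist x z : ℝ) ≤
        R} = Set.univ := Set.eq_univ_of_forall fun z =>
      ((h.lt_dist i j hij x y x z).le.trans hxy)
    have hle := encard_quotientCayley_ball_le (derivedMSeries (FreeGroup (Fin n)) m i) x R
    rw [huniv, Set.encard_univ, ENat.card_eq_coe_natCard] at hle
    exact_mod_cast hle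
  refine (hfin.prod hfin).subset ?_
  rintro ⟨i, j⟩ ⟨hij, x, y, hxy⟩
  exact ⟨key i j hij ⟨x, y, hxy⟩, key j i (Ne.symm hij) ⟨y, x, by rwa [dist_comm]⟩⟩

theorem exists_isDerivedBoxMetric [NeZero m] :
    ∃ _ : MetricSpace (DerivedBoxSpace n m), IsDerivedBoxMetric n m ∧
      ComponentsDiverge
        (fun i : ℕ => FreeGroup (Fin n) ⧸ derivedMSeries (FreeGroup (Fin n)) m i) := by
  have hconn := fun i => quotientCayley_connected (derivedMSeries (FreeGroup (Fin n)) m i)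
  refine exists_isCoarseDisjointUnion _ (fun i x => ?_) (fun i x y => ?_) (fun i x y z => ?_)
    (fun i x y hxy => ?_) fun i => ?_
  · simp [quotientCayleyDist]
  · simp only [quotientCayleyDist, SimpleGraph.dist_comm]
  · simp only [quotientCayleyDist]
    exact_mod_cast (hconn i).dist_triangle
  · rw [quotientCayleyDist, Nat.cast_eq_zero] at hxy
    exact (hconn i).dist_eq_zero_iff.1 hxy
  · have := finite_quotient_derivedMSeries (α := Fin n) m i
    obtain ⟨D, hD⟩ := (Set.finite_range fun p : (FreeGroup (Fin n) ⧸ derivedMSeries _ m i) ×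
      (FreeGroup (Fin n) ⧸ derivedMSeries _ m i) =>
        quotientCayleyDist (Set.range FreeGroup.of) (derivedMSeries _ m i) p.1 p.2).bddAbove
    exact ⟨D, fun x y => hD ⟨(x, y), rfl⟩⟩

variable [MetricSpace (DerivedBoxSpace n m)]

theorem IsDerivedBoxMetric.hasBoundedGeometry [NeZero m] (h : IsDerivedBoxMetric n m)
    (hdiv : ComponentsDiverge
      (fun i : ℕ => FreeGroup (Fin n) ⧸ derivedMSeries (FreeGroup (Fin n)) m i)) :
    HasBoundedGeometry (DerivedBoxSpace n m) := by
  have := finite_quotient_derivedMSeries (α := Fin n) m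
  refine hasBoundedGeometry_of_components hdiv fun r =>
    ⟨{w : FreeGroup (Fin n) | w.norm ≤ ⌊r⌋₊}.ncard, fun i x => ?_⟩
  simp only [h.dist_eq]
  exact encard_quotientCayley_ball_le (derivedMSeries (FreeGroup (Fin n)) m i) x r

theorem IsDerivedBoxMetric.coarselyEmbedsInHilbert [NeZero m] [Fact (1 < m)]
    (h : IsDerivedBoxMetric n m)
    (hdiv : ComponentsDiverge
      (fun i : ℕ => FreeGroup (Fin n) ⧸ derivedMSeries (FreeGroup (Fin n)) m i)) :
    CoarselyEmbedsInHilbert (DerivedBoxSpace n m) := by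
  have hfin := finite_quotient_derivedMSeries (α := Fin n) m
  choose J hJ f hf using exists_feature_map (α := Fin n) m
  refine coarselyEmbedsInHilbert_of_components hdiv f (fun R => ⟨2 * R, fun i x y hxy => ?_⟩)
    fun K => ?_
  · rw [h.dist_eq] at hxy
    exact (hf i x y).1.trans (mul_le_mul_of_nonneg_left hxy zero_le_two)
  · have hbdd : {p : DerivedBoxSpace n m | p.1 ≤ ⌊K⌋₊}.Finite := by
      have : {p : DerivedBoxSpace n m | p.1 ≤ ⌊K⌋₊} ⊆
          ⋃ i ∈ {i | i ≤ ⌊K⌋₊}, Set.range (Sigma.mk i) := fun p hp =>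
        Set.mem_iUnion₂.2 ⟨p.1, hp, p.2, rfl⟩
      exact ((Set.finite_le_nat _).biUnion fun i _ => Set.finite_range _).subset this
    obtain ⟨R, hR⟩ := Metric.isBounded_iff.1 hbdd.isBounded
    refine ⟨max R K, fun i x y hK => ?_⟩
    by_cases hi : i ≤ ⌊K⌋₊
    · exact le_max_of_le_left (hR hi hi)
    · refine le_max_of_le_right ?_
      rw [h.dist_eq]
      -- Beyond index `K` the feature distance lies below the threshold `2 * i`, so the word
      -- distance is controlled; the remaining components form a finite set.
      have hKi : K < i := (Nat.lt_floor_add_one K).trans_le (by exact_mod_cast not_le.1 hi)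
      have hi0 : (0 : ℝ) ≤ i := Nat.cast_nonneg i
      have := (hf i x y).2 (by linarith)
      have h0 : (0 : ℝ) ≤
          (quotientCayley (derivedMSeries (FreeGroup (Fin n)) m i)).dist x y := Nat.cast_nonneg _
      linarith

theorem sum_mul_eq_inner_of_support_subset {ι : Type*} {X : ι → Type*} (i : ι) [Fintype (X i)]
    (u v : lp (fun _ : Σ i, X i => ℝ) 2) (hu : ∀ p, u p ≠ 0 → p.1 = i) :
    ∑ z : X i, u ⟨i, z⟩ * v ⟨i, z⟩ = inner ℝ u v := by
  rw [lp.inner_eq_tsum, tsum_eq_sum (s := Finset.univ.map (Function.Embedding.sigmaMk i))]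
  · simp [mul_comm]
  · rintro ⟨k, z⟩ hp
    by_cases h0 : u ⟨k, z⟩ = 0
    · simp [h0]
    · obtain rfl : k = i := hu _ h0
      simp at hp

theorem IsDerivedBoxMetric.not_hasPropertyA [NeZero m] [Fact (1 < m)] (hn : 2 ≤ n)
    (h : IsDerivedBoxMetric n m) : ¬ HasPropertyA (DerivedBoxSpace n m) := by
  intro hA
  have hdiv := h.componentsDiverge (by omega)
  obtain ⟨S, -, φ, hφ, hclose, hsupp⟩ := hA 1 one_pos (1 / 256) (by norm_num)
  -- The chosen component is more than `S` away from all others, so the supports stay inside it, and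
  -- its relators have length at least `2 * ⌊S⌋₊ + 3`.
  obtain ⟨i, hi⟩ := ((hdiv.finite_left S).union (Set.finite_le_nat (2 * ⌊S⌋₊ + 3))).exists_notMem
  rw [Set.mem_union, not_or] at hi
  have := finite_quotient_derivedMSeries (α := Fin n) m i
  have := Fintype.ofFinite (FreeGroup (Fin n) ⧸ derivedMSeries (FreeGroup (Fin n)) m i)
  have hdist : ∀ x p, φ ⟨i, x⟩ p ≠ 0 → dist (⟨i, x⟩ : DerivedBoxSpace n m) p ≤ S :=
    fun x p hp => by
      rw [dist_comm]
      exact (hsupp ⟨i, x⟩ hp).le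
  have hcomp : ∀ x p, φ ⟨i, x⟩ p ≠ 0 → p.1 = i := fun x p hp => by
    by_contra hne
    exact hi.1 ⟨p.1, Ne.symm hne, x, p.2, hdist x p hp⟩
  refine false_of_almost_equivariant (derivedMSeries (FreeGroup (Fin n)) m i)
    (a := ⟨0, by omega⟩) (b := ⟨1, by omega⟩) (by simp) ⌊S⌋₊ (fun w hw hw1 => ?_)
    (fun x z => φ ⟨i, x⟩ ⟨i, z⟩) (fun x => ?_) (fun x z hxz => ?_) fun x s => ?_
  · have h1 := succ_le_norm_of_mem_derivedMSeries m i w hw hw1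
    have h2 : ¬ i ≤ 2 * ⌊S⌋₊ + 3 := hi.2
    omega
  · simp only [sq]
    rw [sum_mul_eq_inner_of_support_subset i _ _ (hcomp x), real_inner_self_eq_norm_sq, hφ,
      one_pow]
  · have := hdist x _ hxz
    rw [h.dist_eq] at this
    exact exists_norm_le_of_quotientCayley_dist_le _ this
  · rw [sum_mul_eq_inner_of_support_subset i _ _ (hcomp x)]
    have h1 : dist (⟨i, x⟩ : DerivedBoxSpace n m)
        ⟨i, x * (FreeGroup.of s : FreeGroup (Fin n))⟩ ≤ 1 := by
      rw [h.dist_eq]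
      have := quotientCayley_dist_mul_le (derivedMSeries (FreeGroup (Fin n)) m i) x
        (FreeGroup.of s)
      rw [FreeGroup.norm_of] at this
      exact_mod_cast this
    have h2 := (abs_le.1 (hclose _ _ h1)).2
    linarith

end BoxSpace

theorem mainTheorem1 (n m : ℕ) (hm : 3 ≤ m) :
    IsBoxSequence (derivedMSeries (FreeGroup (Fin n)) m) ∧
    (∃ _ : MetricSpace (DerivedBoxSpace n m),
      IsDerivedBoxMetric n m ∧
      ComponentsDiverge
        (fun i : ℕ => FreeGroup (Fin n) ⧸ derivedMSeries (FreeGroup (Fin n)) m i)) ∧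
    ∀ _ : MetricSpace (DerivedBoxSpace n m),
      IsDerivedBoxMetric n m →
      (n = 0 → ComponentsDiverge
        (fun i : ℕ => FreeGroup (Fin n) ⧸ derivedMSeries (FreeGroup (Fin n)) m i)) →
      HasBoundedGeometry (DerivedBoxSpace n m) ∧
      CoarselyEmbedsInHilbert (DerivedBoxSpace n m) ∧
      (2 ≤ n → ¬ HasPropertyA (DerivedBoxSpace n m)) := by
  have : NeZero m := ⟨by omega⟩
  have : Fact (1 < m) := ⟨by omega⟩
  refine ⟨isBoxSequence_derivedMSeries m, exists_isDerivedBoxMetric, fun _ h h0 => ?_⟩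
  have hdiv : ComponentsDiverge
      (fun i : ℕ => FreeGroup (Fin n) ⧸ derivedMSeries (FreeGroup (Fin n)) m i) := by
    by_cases hn : n = 0
    · exact h0 hn
    · exact h.componentsDiverge hn
  exact ⟨h.hasBoundedGeometry hdiv, h.coarselyEmbedsInHilbert hdiv, fun hn => h.not_hasPropertyA hn⟩
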